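/- Let $\vartheta\in(0,1)$, $r>0$, $\rho\in(-1,1)$ be fixed, let $p$ range over the even positive integers, and put $\epsilon_p=p^{-\vartheta}$, $\tau_p=\sqrt{2r\log p}$. Consider the linear model with two halves of data of equal size $n=n_p$, $$y^{(k)}=X^{(k)}\beta+e^{(k)}\in\mathbb R^{n},\qquad k=1,2,$$ where $\beta_1,\dots,\beta_p$ are i.i.d. with law $(1-\epsilon_p)\nu_0+\epsilon_p\nu_{\tau_p}$ ($\nu_a$ is the point mass at $a$), $e^{(1)},e^{(2)}\sim\mathcal N(0,I_{n})$, $\beta,e^{(1)},e^{(2)}$ are independent, and $X^{(1)},X^{(2)}\in\mathbb R^{n\times p}$ are design matrices with $$(X^{(1)})^{\top}X^{(1)}=(X^{(2)})^{\top}X^{(2)}=\tfrac12\,\mathrm{diag}(B,\dots,B),\qquad B=\begin{pmatrix}1&\rho\\ \rho&1\end{pmatrix}.$$ Let $\widehat\beta^{(k)}$ be the least-squares estimate from $(X^{(k)},y^{(k)})$, and let $p(\cdot\mid\beta)$, equivalently $p(\cdot\mid\beta_j)$, be the density of $\widehat\beta_j^{(2)}$ given $\beta$. Define the mirror statistics $$M_j^\star=\log\frac{\mathbb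 E_{\beta\mid X^{(1)},y^{(1)}}\,p(\widehat\beta_j^{(2)}\mid\beta)}{\mathbb E_{\beta\mid X^{(1)},y^{(1)}}\,p(-\widehat\beta_j^{(2)}\mid\beta)},\qquad \widetilde M_j=\log\frac{\mathbb E_{\beta_j\mid\widehat\beta_j^{(1)}}\,p(\widehat\beta_j^{(2)}\mid\beta_j)}{\mathbb E_{\beta_j\mid\widehat\beta_j^{(1)}}\,p(-\widehat\beta_j^{(2)}\mid\beta_j)},$$ $$M_j=\mathrm{sgn}\big(\widehat\beta_j^{(1)}\widehat\beta_j^{(2)}\big)\big(|\widehat\beta_j^{(1)}|+|\widehat\beta_j^{(2)}|\big),$$ where the expectations are over the posteriors of $\beta$ and of $\beta_j$ (with the above prior). For $W\in\{M^\star,\widetilde M,M\}$ let $S_1=\{j:\beta_j\ne0\}$, $\widehat S_1(u)=\{j:W_j\ge t(u)\}$ with $t(u)=2u\log p$ for $M^\star,\widetilde M$ and $t(u)=\sqrt{2u\log p}$ for $M$, and $$\mathrm{Hamm}^\star_W=\inf_{u>0}\big(\mathbb E|\widehat S_1(u)\setminus S_1|+\mathbb E|S_1\setminus\widehat S_1(u)|\big).$$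 Say that $W$ has Hamming rate $f^\star_{\mathrm{Hamm},W}\in\mathbb R$ if $\mathrm{Hamm}^\star_W=L_p\,p^{f^\star_{\mathrm{Hamm},W}}$ for all large $p$, with a multi-log term $L_p$, i.e. $L_pp^{\delta}\to\infty$ and $L_pp^{-\delta}\to0$ for every $\delta>0$ as $p\to\infty$. Then the three Hamming rates exist, $$f^\star_{\mathrm{Hamm},M^\star}\le 1-\vartheta-\min\left(\frac{\big((1-\rho^2/2)r-\vartheta\big)_+^2}{4(1-\rho^2/2)r},\ \frac{(1-|\rho|)(3+|\rho|)r}{8}\right),$$ and $$f^\star_{\mathrm{Hamm},M^\star}\le f^\star_{\mathrm{Hamm},\widetilde M}=f^\star_{\mathrm{Hamm},M}=1-\vartheta-\frac{\big((1-\rho^2)r-\vartheta\big)_+^2}{4(1-\rho^2)r},$$ where the inequality is strict when $r>\vartheta/(1-\rho^2/2)$ and $\rho\ne0$. -/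

import Mathlib

open MeasureTheory ProbabilityTheory Filter Topology
open scoped Matrix ENNReal NNReal

namespace MirrorStat

noncomputable section

/-! ### The Gaussian linear model with a spike-and-slab prior -/

/-- The spike-and-slab law `(1 - ε) ν₀ + ε ν_τ` on the real line, `ν_a` the point mass at `a`. -/
def spikeSlab (ε τ : ℝ) : Measure ℝ :=
  ENNReal.ofReal (1 - ε) • Measure.dirac 0 + ENNReal.ofReal ε • Measure.dirac τ

/-- The prior of the coefficient vector: i.i.d. spike-and-slab coordinates. -/
def coefPrior (ι : Type) [Fintype ι] (ε τ : ℝ) : Measure (ι → ℝ) :=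
  Measure.pi fun _ => spikeSlab ε τ

/-- The law of `n` i.i.d. standard Gaussian errors. -/
def noiseLaw (n : ℕ) : Measure (Fin n → ℝ) :=
  Measure.pi fun _ => gaussianReal 0 1

/-- The joint law of `(β, e⁽¹⁾, e⁽²⁾)`: the coefficient vector and the error vectors of the two
halves of the data, all independent. -/
def modelLaw (ι : Type) [Fintype ι] (n : ℕ) (ε τ : ℝ) :
    Measure ((ι → ℝ) × (Fin n → ℝ) × (Fin n → ℝ)) :=
  (coefPrior ι ε τ).prod ((noiseLaw n).prod (noiseLaw n))

/-- The response vector `y = X β + e`. -/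
def response {ι : Type} [Fintype ι] {n : ℕ} (X : Matrix (Fin n) ι ℝ) (β : ι → ℝ)
    (e : Fin n → ℝ) : Fin n → ℝ :=
  X *ᵥ β + e

/-- The least-squares (maximum likelihood) estimate `(XᵀX)⁻¹ Xᵀ y`. -/
def ols {ι : Type} [Fintype ι] [DecidableEq ι] {n : ℕ} (X : Matrix (Fin n) ι ℝ)
    (y : Fin n → ℝ) : ι → ℝ :=
  (Xᵀ * X)⁻¹ *ᵥ (Xᵀ *ᵥ y)

/-- The sampling variance `((XᵀX)⁻¹)ⱼⱼ` of the `j`-th least-squares coefficient; given `β`, that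
coefficient has the law `N(βⱼ, olsVar X j)`. -/
def olsVar {ι : Type} [Fintype ι] [DecidableEq ι] {n : ℕ} (X : Matrix (Fin n) ι ℝ)
    (j : ι) : ℝ≥0 :=
  ((Xᵀ * X)⁻¹ j j).toNNReal

/-! ### Posteriors and mirror statistics -/

/-- Bayes' formula: the posterior for the prior `π` and the likelihood `L`. -/
def posterior {Θ : Type} [MeasurableSpace Θ] (π : Measure Θ) (L : Θ → ℝ≥0∞) : Measure Θ :=
  (∫⁻ θ, L θ ∂π)⁻¹ • π.withDensity L

/-- The likelihood of `β` given one half of the data: the density of `N(X β, I)` at `y`. -/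
def likelihood {ι : Type} [Fintype ι] {n : ℕ} (X : Matrix (Fin n) ι ℝ) (y : Fin n → ℝ)
    (β : ι → ℝ) : ℝ≥0∞ :=
  ∏ i, gaussianPDF ((X *ᵥ β) i) 1 (y i)

/-- The predictive density at `t` of the `j`-th least-squares coefficient of the second half given
the whole first half `(X₁, y₁)`: the mean of `p(t ∣ β)` under the full posterior of `β`. -/
def predictiveStar {ι : Type} [Fintype ι] [DecidableEq ι] {n : ℕ} (ε τ : ℝ)
    (X₁ X₂ : Matrix (Fin n) ι ℝ) (y₁ : Fin n → ℝ) (j : ι) (t : ℝ) : ℝ :=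
  ∫ β, gaussianPDFReal (β j) (olsVar X₂ j) t ∂(posterior (coefPrior ι ε τ) (likelihood X₁ y₁))

/-- The Bayes-optimal mirror statistic `M⋆`. -/
def mirrorStar {ι : Type} [Fintype ι] [DecidableEq ι] {n : ℕ} (ε τ : ℝ)
    (X₁ X₂ : Matrix (Fin n) ι ℝ) (y₁ y₂ : Fin n → ℝ) (j : ι) : ℝ :=
  Real.log (predictiveStar ε τ X₁ X₂ y₁ j (ols X₂ y₂ j) /
    predictiveStar ε τ X₁ X₂ y₁ j (-(ols X₂ y₂ j)))

/-- The predictive density at `t` of the `j`-th least-squares coefficient of the second half given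
only the `j`-th least-squares coefficient of the first half: the mean of `p(t ∣ βⱼ)` under the
posterior of `βⱼ`. -/
def predictiveTilde {ι : Type} [Fintype ι] [DecidableEq ι] {n : ℕ} (ε τ : ℝ)
    (X₁ X₂ : Matrix (Fin n) ι ℝ) (y₁ : Fin n → ℝ) (j : ι) (t : ℝ) : ℝ :=
  ∫ b, gaussianPDFReal b (olsVar X₂ j) t
    ∂(posterior (spikeSlab ε τ) fun b => gaussianPDF b (olsVar X₁ j) (ols X₁ y₁ j))

/-- The mirror statistic `M̃`, which ignores the other coefficients of the first half. -/
def mirrorTilde {ι : Type} [Fintype ι] [DecidableEq ι] {n : ℕ} (ε τ : ℝ)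
    (X₁ X₂ : Matrix (Fin n) ι ℝ) (y₁ y₂ : Fin n → ℝ) (j : ι) : ℝ :=
  Real.log (predictiveTilde ε τ X₁ X₂ y₁ j (ols X₂ y₂ j) /
    predictiveTilde ε τ X₁ X₂ y₁ j (-(ols X₂ y₂ j)))

/-- The sign-sum mirror statistic `M`. -/
def mirrorSum {ι : Type} [Fintype ι] [DecidableEq ι] {n : ℕ}
    (X₁ X₂ : Matrix (Fin n) ι ℝ) (y₁ y₂ : Fin n → ℝ) (j : ι) : ℝ :=
  Real.sign (ols X₁ y₁ j * ols X₂ y₂ j) * (|ols X₁ y₁ j| + |ols X₂ y₂ j|)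

/-! ### Hamming errors and their rates -/

/-- The set of truly relevant features. -/
def relevant {ι : Type} (β : ι → ℝ) : Set ι := {j | β j ≠ 0}

/-- The set of features selected by the statistic `W` at the threshold `t`. -/
def selected {ι : Type} (W : ι → ℝ) (t : ℝ) : Set ι := {j | t ≤ W j}

/-- Expected number of false positives of the statistic `W`, a function of the two response
vectors, at the threshold `t`. -/
def falsePos {ι : Type} [Fintype ι] {n : ℕ} (ε τ : ℝ) (X₁ X₂ : Matrix (Fin n) ι ℝ)
    (W : (Fin n → ℝ) → (Fin n → ℝ) → ι → ℝ) (t : ℝ) : ℝ :=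
  ∫ ω, ((selected (W (response X₁ ω.1 ω.2.1) (response X₂ ω.1 ω.2.2)) t
    \ relevant ω.1).ncard : ℝ) ∂(modelLaw ι n ε τ)

/-- Expected number of false negatives. -/
def falseNeg {ι : Type} [Fintype ι] {n : ℕ} (ε τ : ℝ) (X₁ X₂ : Matrix (Fin n) ι ℝ)
    (W : (Fin n → ℝ) → (Fin n → ℝ) → ι → ℝ) (t : ℝ) : ℝ :=
  ∫ ω, ((relevant ω.1
    \ selected (W (response X₁ ω.1 ω.2.1) (response X₂ ω.1 ω.2.2)) t).ncard : ℝ)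
    ∂(modelLaw ι n ε τ)

/-- The minimal expected Hamming error over the thresholds `t u`, `u > 0`. -/
def hammStar {ι : Type} [Fintype ι] {n : ℕ} (ε τ : ℝ) (X₁ X₂ : Matrix (Fin n) ι ℝ)
    (W : (Fin n → ℝ) → (Fin n → ℝ) → ι → ℝ) (t : ℝ → ℝ) : ℝ :=
  ⨅ u : Set.Ioi (0 : ℝ), (falsePos ε τ X₁ X₂ W (t u) + falseNeg ε τ X₁ X₂ W (t u))

/-- `L` is a multi-log term in `p`: `L p ^ δ → ∞` and `L p ^ (-δ) → 0` for every `δ > 0`. -/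
def IsMultiLog (p L : ℕ → ℝ) : Prop :=
  ∀ δ : ℝ, 0 < δ → Tendsto (fun m => L m * p m ^ δ) atTop atTop ∧
    Tendsto (fun m => L m * p m ^ (-δ)) atTop (𝓝 0)

/-- `H = L_p p ^ f` for a multi-log term `L_p`. -/
def HasRate (p H : ℕ → ℝ) (f : ℝ) : Prop :=
  ∃ L : ℕ → ℝ, IsMultiLog p L ∧ ∀ᶠ m in atTop, H m = L m * p m ^ f

/-! ### The Rare/Weak calibration with `2 × 2` blocks

The number of features is `p = 2 m`; a feature is a pair (position in its block, block). -/

/-- The number of features. -/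
def numFeat (m : ℕ) : ℝ := 2 * m

/-- `ε_p = p ^ (-ϑ)`. -/
def rarity (ϑ : ℝ) (m : ℕ) : ℝ := numFeat m ^ (-ϑ)

/-- `τ_p = √(2 r log p)`. -/
def strength (r : ℝ) (m : ℕ) : ℝ := √(2 * r * Real.log (numFeat m))

/-- The Gram matrix `(1/2) diag(B, …, B)` with `m` blocks `B = [1, ρ; ρ, 1]`. -/
def blockGram (ρ : ℝ) (m : ℕ) : Matrix (Fin 2 × Fin m) (Fin 2 × Fin m) ℝ :=
  (1 / 2 : ℝ) • Matrix.blockDiagonal fun _ : Fin m => !![1, ρ; ρ, 1]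

/-- The minimal Hamming error of `M⋆`, with thresholds `2 u log p`. -/
def hammMirrorStar (ϑ r : ℝ) {n : ℕ → ℕ} (X₁ X₂ : ∀ m, Matrix (Fin (n m)) (Fin 2 × Fin m) ℝ)
    (m : ℕ) : ℝ :=
  hammStar (rarity ϑ m) (strength r m) (X₁ m) (X₂ m)
    (mirrorStar (rarity ϑ m) (strength r m) (X₁ m) (X₂ m))
    fun u => 2 * u * Real.log (numFeat m)

/-- The minimal Hamming error of `M̃`, with thresholds `2 u log p`. -/
def hammMirrorTilde (ϑ r : ℝ) {n : ℕ → ℕ}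
    (X₁ X₂ : ∀ m, Matrix (Fin (n m)) (Fin 2 × Fin m) ℝ) (m : ℕ) : ℝ :=
  hammStar (rarity ϑ m) (strength r m) (X₁ m) (X₂ m)
    (mirrorTilde (rarity ϑ m) (strength r m) (X₁ m) (X₂ m))
    fun u => 2 * u * Real.log (numFeat m)

/-- The minimal Hamming error of the sign-sum statistic `M`, with thresholds `√(2 u log p)`. -/
def hammMirrorSum (ϑ r : ℝ) {n : ℕ → ℕ} (X₁ X₂ : ∀ m, Matrix (Fin (n m)) (Fin 2 × Fin m) ℝ)
    (m : ℕ) : ℝ :=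
  hammStar (rarity ϑ m) (strength r m) (X₁ m) (X₂ m) (mirrorSum (X₁ m) (X₂ m))
    fun u => √(2 * u * Real.log (numFeat m))

end

end MirrorStat

open MirrorStat

namespace MirrorStat

noncomputable section

/-! ### Shifts and linear functionals of a standard Gaussian vector -/

/-! Put `L = log p`. A statistic at feature `j` sees the data only through a few linear functionals,
so its errors at `j` are those of a test in a Gaussian shift experiment with four states: `j` and
its partner in the block are each a spike or not (`falsePos_falseNeg_eq_sum`). Let `f` and `g` be
the joint densities of the data with `βⱼ = 0` and with `βⱼ = τ`. The Bayes error `∫ min f g` is a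
lower bound for every test. Splitting the mixtures into pairs of states, Chernoff's bound and a
matching slab estimate show that it is `p ^ (-bayesExp + o(1))` (`bayesErr_le_exp`,
`exists_exp_le_bayesErr`). Here `bayesExp` is the least, over the four pairs, of the maximum over
`l` of `l α + (1 - l) α' + l (1 - l) Δ`, where `α`, `α'` are prior exponents and `2 Δ L` is the
squared distance of the means.

Both `M⋆` and `M̃` equal `log ((f + g) / (f + g exp (-2 η·z)))`, because reflecting the second
estimate flips the sign of its log-likelihood ratio. A value above `log 2` forces `g ≥ f`, so false
positives cost at most the Bayes error. A spike is missed at a small threshold either where `g` is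
at most a small power of `p` times `f`, or because `η·z` is nearly nonpositive. The second event has
exponent `ϑ + a` with `a = (1 - ρ²) r / 2`, and for `η·z ≤ 0` a miss is certain. Hence the rate is
exactly `1 - min bayesExp (ϑ + a)` (`hasRate_of_mirrorLog`).

For `M̃` all four distances are `Δ = (1 - ρ²) r`, and `bayesExp = ϑ + (Δ - ϑ)₊² / (4Δ) ≤ ϑ + Δ / 4`
lies below `ϑ + a`. For `M` the sum of the two estimates is the Bayes statistic of the same
experiment; the signs only double the false positives and add misses of exponent `ϑ + Δ / 2`, so the
rate is the same (`signSum_error_le`).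

For `M⋆` the pairs with equal partner states have the larger distance `(1 - ρ² / 2) r`. The other
two pairs have prior exponents of mean `ϑ` and distance at least `(1 - |ρ|)(3 + |ρ|) r / 2`, so
weight `l = 1/2` gives the second term of the minimum (`le_bayesExp_starDist`). Both terms are at
least the exponent of `M̃`, strictly so in the stated range. -/

/-- The law of a vector of i.i.d. standard Gaussian coordinates. -/
def stdGauss (κ : Type) [Fintype κ] : Measure (κ → ℝ) :=
  Measure.pi fun _ => gaussianReal 0 1

instance (κ : Type) [Fintype κ] : IsProbabilityMeasure (stdGauss κ) := by
  unfold stdGauss; infer_instance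

/-- The Cameron–Martin density of the shift of `stdGauss κ` by `μ`. -/
def cmDens {κ : Type} [Fintype κ] (μ z : κ → ℝ) : ℝ :=
  Real.exp (μ ⬝ᵥ z - μ ⬝ᵥ μ / 2)

section Gauss

variable {κ : Type} [Fintype κ]

lemma cmDens_pos (μ z : κ → ℝ) : 0 < cmDens μ z := Real.exp_pos _

@[fun_prop]
lemma measurable_dotProduct (μ : κ → ℝ) : Measurable fun z : κ → ℝ => μ ⬝ᵥ z := by
  unfold dotProduct; fun_prop

@[fun_prop]
lemma measurable_cmDens (μ : κ → ℝ) : Measurable (cmDens μ) := by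
  unfold cmDens; fun_prop

lemma gaussianReal_eq_withDensity (a : ℝ) :
    gaussianReal a 1 =
      (gaussianReal 0 1).withDensity fun x => ENNReal.ofReal (Real.exp (a * x - a * a / 2)) := by
  rw [gaussianReal_of_var_ne_zero _ one_ne_zero, gaussianReal_of_var_ne_zero _ one_ne_zero,
    ← withDensity_mul _ (measurable_gaussianPDF _ _) (by fun_prop)]
  congr 1
  ext x
  simp only [gaussianPDF, Pi.mul_apply]
  rw [← ENNReal.ofReal_mul (gaussianPDFReal_nonneg _ _ _)]
  congr 1
  simp only [gaussianPDFReal, mul_assoc, ← Real.exp_add]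
  congr 3
  simp
  ring

lemma stdGauss_map_add (μ : κ → ℝ) :
    (stdGauss κ).map (fun e => μ + e) =
      (stdGauss κ).withDensity fun z => ENNReal.ofReal (cmDens μ z) := by
  have h1 : (stdGauss κ).map (fun e => μ + e) = Measure.pi fun k => gaussianReal (μ k) 1 := by
    have := Measure.pi_map_pi (μ := fun _ : κ => gaussianReal 0 1) (f := fun k x => μ k + x)
      (fun k => by fun_prop)
    simp only [gaussianReal_map_const_add, zero_add] at this
    exact this
  rw [h1]
  refine Measure.pi_eq fun s hs => ?_
  rw [withDensity_apply _ (MeasurableSet.univ_pi hs), ← lintegral_indicator (MeasurableSet.univ_pi hs)]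
  -- On a box both the indicator and the exponential factor over the coordinates, which reduces the
  -- claim to `gaussianReal_eq_withDensity`.
  have h2 : ∀ z : κ → ℝ, (Set.univ.pi s).indicator (fun z => ENNReal.ofReal (cmDens μ z)) z =
      ∏ k, (s k).indicator (fun x => ENNReal.ofReal (Real.exp (μ k * x - μ k * μ k / 2))) (z k) := by
    intro z
    by_cases hz : z ∈ Set.univ.pi s
    · rw [Set.indicator_of_mem hz,
        Finset.prod_congr rfl fun k _ => Set.indicator_of_mem (hz k (Set.mem_univ k)) _,
        ← ENNReal.ofReal_prod_of_nonneg fun _ _ => (Real.exp_pos _).le, ← Real.exp_sum]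
      simp [cmDens, dotProduct, Finset.sum_sub_distrib, Finset.sum_div]
    · rw [Set.indicator_of_notMem hz]
      simp only [Set.mem_pi, Set.mem_univ, true_implies, not_forall] at hz
      obtain ⟨k, hk⟩ := hz
      exact (Finset.prod_eq_zero (Finset.mem_univ k) (Set.indicator_of_notMem hk _)).symm
  simp_rw [h2]
  have hm : ∀ k, Measurable
      ((s k).indicator (fun x => ENNReal.ofReal (Real.exp (μ k * x - μ k * μ k / 2)))) :=
    fun k => Measurable.indicator (by fun_prop) (hs k)
  rw [stdGauss, lintegral_prod_eq_prod_lintegral_of_indepFun Finset.univ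
    (fun k (z : κ → ℝ) => (s k).indicator
      (fun x => ENNReal.ofReal (Real.exp (μ k * x - μ k * μ k / 2))) (z k))
    (iIndepFun_pi fun k => (hm k).aemeasurable) (fun k => (hm k).comp (measurable_pi_apply k))]
  refine Finset.prod_congr rfl fun k _ => ?_
  rw [gaussianReal_eq_withDensity (μ k), withDensity_apply _ (hs k), ← lintegral_indicator (hs k)]
  have := (measurePreserving_eval (fun _ : κ => gaussianReal 0 1) k).lintegral_comp (hm k)
  simpa using this

lemma integrable_cmDens (μ : κ → ℝ) : Integrable (cmDens μ) (stdGauss κ) := by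
  refine (lintegral_ofReal_ne_top_iff_integrable (measurable_cmDens μ).aestronglyMeasurable
    (Eventually.of_forall fun z => (cmDens_pos μ z).le)).1 ?_
  have h := congrArg (fun m => m Set.univ) (stdGauss_map_add μ)
  simp only [withDensity_apply _ MeasurableSet.univ, Measure.restrict_univ] at h
  rw [← h]
  exact measure_ne_top _ _

/-- The change of variables `e ↦ μ + e` for a standard Gaussian vector. -/
lemma integral_shift (μ : κ → ℝ) (F : (κ → ℝ) → ℝ) (hF : Measurable F) :
    ∫ e, F (μ + e) ∂stdGauss κ = ∫ z, F z * cmDens μ z ∂stdGauss κ := by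
  rw [← integral_map (φ := fun e => μ + e) (f := F) (by fun_prop) hF.aestronglyMeasurable,
    stdGauss_map_add, integral_withDensity_eq_integral_toReal_smul (by fun_prop) (by simp)]
  refine integral_congr_ae (Eventually.of_forall fun z => ?_)
  simp [ENNReal.toReal_ofReal (cmDens_pos μ z).le, mul_comm]

lemma integral_cmDens (μ : κ → ℝ) : ∫ z, cmDens μ z ∂stdGauss κ = 1 := by
  have := integral_shift μ (fun _ => 1) measurable_const
  simpa using this.symm

lemma measureReal_shift (μ : κ → ℝ) {S : Set (κ → ℝ)} (hS : MeasurableSet S) :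
    (stdGauss κ).real {e | μ + e ∈ S} = ∫ z in S, cmDens μ z ∂stdGauss κ := by
  have h := integral_shift μ (S.indicator 1) (measurable_one.indicator hS)
  have h1 : ∀ e, S.indicator (1 : (κ → ℝ) → ℝ) (μ + e) = {e | μ + e ∈ S}.indicator 1 e :=
    fun e => rfl
  have h2 : MeasurableSet {e | μ + e ∈ S} := by
    have : Measurable fun e : κ → ℝ => μ + e := by fun_prop
    exact this hS
  simp_rw [h1] at h
  rw [integral_indicator_one h2] at h
  rw [h, ← integral_indicator hS]
  refine integral_congr_ae (Eventually.of_forall fun z => ?_)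
  by_cases hz : z ∈ S <;> simp [hz]

/-- By characteristic functions: `exp (i t d·e)` is a product over independent coordinates, and the
variances `d k ^ 2` add up. -/
lemma stdGauss_map_dotProduct (d : κ → ℝ) :
    (stdGauss κ).map (fun e => d ⬝ᵥ e) = gaussianReal 0 (d ⬝ᵥ d).toNNReal := by
  have : IsProbabilityMeasure ((stdGauss κ).map (fun e => d ⬝ᵥ e)) :=
    Measure.isProbabilityMeasure_map (by fun_prop)
  refine Measure.ext_of_charFun ?_
  ext t
  rw [charFun_gaussianReal, charFun_apply_real, integral_map (by fun_prop) (by fun_prop)]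
  have h : ∀ e : κ → ℝ, Complex.exp (t * ((d ⬝ᵥ e : ℝ) : ℂ) * Complex.I) =
      ∏ k, Complex.exp ((t * d k : ℝ) * (e k : ℂ) * Complex.I) := by
    intro e
    rw [← Complex.exp_sum]
    congr 1
    simp only [dotProduct]
    push_cast
    rw [Finset.mul_sum, Finset.sum_mul]
    exact Finset.sum_congr rfl fun k _ => by ring
  simp_rw [h]
  rw [stdGauss, integral_fintype_prod_eq_prod
    (f := fun k (x : ℝ) => Complex.exp ((t * d k : ℝ) * (x : ℂ) * Complex.I))]
  simp_rw [← charFun_apply_real, charFun_gaussianReal, ← Complex.exp_sum]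
  congr 1
  have hd : (0 : ℝ) ≤ d ⬝ᵥ d := Finset.sum_nonneg fun k _ => mul_self_nonneg _
  have hd2 : (((d ⬝ᵥ d).toNNReal : ℝ) : ℂ) = ∑ k, (d k : ℂ) * d k := by
    rw [Real.coe_toNNReal _ hd, dotProduct]
    push_cast
    rfl
  rw [hd2]
  push_cast
  simp only [mul_zero, zero_mul, zero_sub, Finset.sum_neg_distrib, Finset.sum_mul, Finset.sum_div]
  congr 1
  exact Finset.sum_congr rfl fun k _ => by ring

lemma measureReal_dotProduct (d : κ → ℝ) {T : Set ℝ} (hT : MeasurableSet T) :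
    (stdGauss κ).real {e | d ⬝ᵥ e ∈ T} = (gaussianReal 0 (d ⬝ᵥ d).toNNReal).real T := by
  rw [← stdGauss_map_dotProduct, map_measureReal_apply (by fun_prop) hT]
  rfl

/-- Chernoff's bound for a linear functional of a standard Gaussian vector. -/
lemma measureReal_dotProduct_le (d : κ → ℝ) {y : ℝ} (hd : 0 < d ⬝ᵥ d) (hy : y ≤ 0) :
    (stdGauss κ).real {e | d ⬝ᵥ e ≤ y} ≤ Real.exp (-(y ^ 2 / (2 * (d ⬝ᵥ d)))) := by
  have hdN := Real.coe_toNNReal _ hd.le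
  have h := measure_le_le_exp_mul_mgf (μ := gaussianReal 0 (d ⬝ᵥ d).toNNReal) (X := id)
    (t := y / (d ⬝ᵥ d)) y (div_nonpos_of_nonpos_of_nonneg hy hd.le)
    (integrable_exp_mul_gaussianReal _)
  have h2 := measureReal_dotProduct d (T := Set.Iic y) measurableSet_Iic
  rw [mgf_id_gaussianReal, hdN, ← Real.exp_add] at h
  refine (h2.trans_le h).trans_eq ?_
  congr 1
  field_simp
  ring

lemma le_gaussianReal_Icc {c : ℝ} (hc : 0 ≤ c) :
    (√(2 * Real.pi))⁻¹ * Real.exp (-((c + 1) ^ 2 / 2)) ≤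
      (gaussianReal 0 1).real (Set.Icc c (c + 1)) := by
  rw [measureReal_def, gaussianReal_apply_eq_integral _ one_ne_zero, ENNReal.toReal_ofReal
    (integral_nonneg fun x => gaussianPDFReal_nonneg _ _ _)]
  have h : ∫ x in Set.Icc c (c + 1), (√(2 * Real.pi))⁻¹ * Real.exp (-((c + 1) ^ 2 / 2)) ≤
      ∫ x in Set.Icc c (c + 1), gaussianPDFReal 0 1 x := by
    refine setIntegral_mono_on (integrableOn_const (by simp)) (integrable_gaussianPDFReal 0 1).integrableOn
      measurableSet_Icc fun x hx => ?_
    simp only [gaussianPDFReal, NNReal.coe_one, mul_one, sub_zero]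
    have : x ^ 2 ≤ (c + 1) ^ 2 := by nlinarith [hx.1, hx.2]
    gcongr
    rw [neg_div]
    gcongr
  simpa using h

/-- The normalized functional is standard normal, and its density on `[c, c + 1]` is at least the
value at `c + 1`. This is the converse to Chernoff's bound: with `c` of order `√L`, the unit width
costs only a factor `exp (-O(√L))`. -/
lemma le_measureReal_dotProduct_slab (d : κ → ℝ) (hd : 0 < d ⬝ᵥ d) {c : ℝ} (hc : 0 ≤ c) :
    (√(2 * Real.pi))⁻¹ * Real.exp (-((c + 1) ^ 2 / 2)) ≤
      (stdGauss κ).real {e | c * √(d ⬝ᵥ d) ≤ d ⬝ᵥ e ∧ d ⬝ᵥ e ≤ (c + 1) * √(d ⬝ᵥ d)} := by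
  refine (le_gaussianReal_Icc hc).trans_eq ?_
  have hs := Real.sqrt_pos.2 hd
  set θ : κ → ℝ := (√(d ⬝ᵥ d))⁻¹ • d with hθ
  have h1 : θ ⬝ᵥ θ = 1 := by
    simp only [hθ, smul_dotProduct, dotProduct_smul, smul_eq_mul]
    rw [← mul_assoc, ← mul_inv, Real.mul_self_sqrt hd.le, inv_mul_cancel₀ hd.ne']
  have h := measureReal_dotProduct θ (T := Set.Icc c (c + 1)) measurableSet_Icc
  rw [h1, Real.toNNReal_one] at h
  rw [← h]
  congr 1
  ext e
  simp only [hθ, smul_dotProduct, smul_eq_mul, Set.mem_Icc, Set.mem_ofPred_eq]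
  rw [inv_mul_eq_div, le_div_iff₀ hs, div_le_iff₀ hs]

end Gauss

/-! ### Testing one coefficient in a Gaussian shift experiment

A state is a pair of Booleans: whether the coefficient of interest is a spike, and whether its
partner is. In the state `(b, b')` the data are a standard Gaussian vector shifted by `M b b'`. -/

/-- The prior weight of a coefficient being a spike (`true`) or not (`false`). -/
def spikeWeight (ε : ℝ) (b : Bool) : ℝ := bif b then ε else 1 - ε

/-- The density of the data, jointly with the coefficient of interest being in the state `b`. -/
def margDens {κ : Type} [Fintype κ] (ε : ℝ) (M : Bool → Bool → κ → ℝ) (b : Bool) (z : κ → ℝ) : ℝ :=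
  ∑ b' : Bool, spikeWeight ε b * spikeWeight ε b' * cmDens (M b b') z

/-- The Bayes error for deciding whether the coefficient of interest is a spike. -/
def bayesErr {κ : Type} [Fintype κ] (ε : ℝ) (M : Bool → Bool → κ → ℝ) : ℝ :=
  ∫ z, min (margDens ε M false z) (margDens ε M true z) ∂stdGauss κ

/-- The log-likelihood-ratio mirror statistic. -/
def mirrorLog {κ : Type} [Fintype κ] (ε : ℝ) (M : Bool → Bool → κ → ℝ) (η z : κ → ℝ) : ℝ :=
  Real.log ((margDens ε M false z + margDens ε M true z) /
    (margDens ε M false z + margDens ε M true z * Real.exp (-(2 * (η ⬝ᵥ z)))))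

lemma spikeWeight_pos {ε : ℝ} (h0 : 0 < ε) (h1 : ε < 1) (b : Bool) : 0 < spikeWeight ε b := by
  cases b <;> simp [spikeWeight, h0, h1]

section Testing

variable {κ : Type} [Fintype κ] {ε : ℝ} {M : Bool → Bool → κ → ℝ}

lemma margDens_pos (h0 : 0 < ε) (h1 : ε < 1) (b : Bool) (z : κ → ℝ) : 0 < margDens ε M b z :=
  Finset.sum_pos (fun b' _ => mul_pos (mul_pos (spikeWeight_pos h0 h1 b) (spikeWeight_pos h0 h1 b'))
    (cmDens_pos _ _)) Finset.univ_nonempty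

@[fun_prop]
lemma measurable_margDens (b : Bool) : Measurable (margDens ε M b) := by
  unfold margDens; fun_prop

lemma integrable_margDens (b : Bool) : Integrable (margDens ε M b) (stdGauss κ) :=
  integrable_finsetSum _ fun _ _ => (integrable_cmDens _).const_mul _

@[fun_prop]
lemma measurable_mirrorLog (η : κ → ℝ) : Measurable (mirrorLog ε M η) := by
  unfold mirrorLog; fun_prop

lemma setIntegral_margDens (b : Bool) {S : Set (κ → ℝ)} (hS : MeasurableSet S) :
    ∫ z in S, margDens ε M b z ∂stdGauss κ =
      ∑ b' : Bool, spikeWeight ε b * spikeWeight ε b' * (stdGauss κ).real {e | M b b' + e ∈ S} := by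
  unfold margDens
  rw [integral_finsetSum _ fun b' _ => ((integrable_cmDens _).const_mul _).integrableOn]
  refine Finset.sum_congr rfl fun b' _ => ?_
  rw [integral_const_mul, measureReal_shift _ hS]

lemma integrable_min_margDens :
    Integrable (fun z => min (margDens ε M false z) (margDens ε M true z)) (stdGauss κ) :=
  (integrable_margDens false).inf (integrable_margDens true)

/-- No test has a smaller error than the Bayes error. -/
lemma bayesErr_le (S : Set (κ → ℝ)) (hS : MeasurableSet S) :
    bayesErr ε M ≤ ∫ z in S, margDens ε M false z ∂stdGauss κ +
      ∫ z in Sᶜ, margDens ε M true z ∂stdGauss κ := by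
  rw [bayesErr, ← integral_add_compl hS integrable_min_margDens]
  exact add_le_add
    (setIntegral_mono integrable_min_margDens.integrableOn (integrable_margDens _).integrableOn
      fun z => min_le_left _ _)
    (setIntegral_mono integrable_min_margDens.integrableOn (integrable_margDens _).integrableOn
      fun z => min_le_right _ _)

/-- The device for upper bounds: wherever the density of the wrongly decided hypothesis is within a
factor `C` of the pointwise minimum, the error is charged to the Bayes error. -/
lemma setIntegral_le_mul_bayesErr (h0 : 0 < ε) (h1 : ε < 1) {S : Set (κ → ℝ)}
    (hS : MeasurableSet S) (b : Bool) {C : ℝ}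
    (h : ∀ z ∈ S, margDens ε M b z ≤ C * min (margDens ε M false z) (margDens ε M true z))
    (hC : 0 ≤ C) :
    ∫ z in S, margDens ε M b z ∂stdGauss κ ≤ C * bayesErr ε M := by
  rw [bayesErr, ← integral_const_mul]
  refine (setIntegral_mono_on (integrable_margDens b).integrableOn
    (integrable_min_margDens.const_mul C).integrableOn hS h).trans ?_
  exact setIntegral_le_integral (integrable_min_margDens.const_mul C) (Eventually.of_forall
    fun z => mul_nonneg hC (le_min (margDens_pos h0 h1 _ _).le (margDens_pos h0 h1 _ _).le))

/-- Chernoff's bound for the error of testing one Gaussian shift against another. -/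
lemma integral_min_cmDens_le (μ μ' : κ → ℝ) {a a' A A' l : ℝ} (haA : a ≤ Real.exp (-A))
    (haA' : a' ≤ Real.exp (-A')) (hl0 : 0 ≤ l) (hl1 : l ≤ 1) :
    ∫ z, min (a * cmDens μ z) (a' * cmDens μ' z) ∂stdGauss κ ≤
      Real.exp (-(l * A + (1 - l) * A' + l * (1 - l) * ((μ' - μ) ⬝ᵥ (μ' - μ)) / 2)) := by
  -- The minimum is at most the geometric mean with weights `l` and `1 - l`. That mean of two
  -- Cameron–Martin densities is `exp (-l (1 - l) |μ' - μ|² / 2)` times the density of the shift by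
  -- `m`, which integrates to one.
  set m : κ → ℝ := l • μ + (1 - l) • μ' with hm
  have key : ∀ z, min (a * cmDens μ z) (a' * cmDens μ' z) ≤
      Real.exp (-(l * A + (1 - l) * A' + l * (1 - l) * ((μ' - μ) ⬝ᵥ (μ' - μ)) / 2)) *
        cmDens m z := by
    intro z
    have e1 : a * cmDens μ z ≤ Real.exp (-A + (μ ⬝ᵥ z - μ ⬝ᵥ μ / 2)) := by
      rw [Real.exp_add]; exact mul_le_mul_of_nonneg_right haA (cmDens_pos _ _).le
    have e2 : a' * cmDens μ' z ≤ Real.exp (-A' + (μ' ⬝ᵥ z - μ' ⬝ᵥ μ' / 2)) := by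
      rw [Real.exp_add]; exact mul_le_mul_of_nonneg_right haA' (cmDens_pos _ _).le
    refine (min_le_min e1 e2).trans ?_
    rw [cmDens, ← Real.exp_add, ← Real.exp_monotone.map_min, Real.exp_le_exp]
    generalize hP : -A + (μ ⬝ᵥ z - μ ⬝ᵥ μ / 2) = P
    generalize hQ : -A' + (μ' ⬝ᵥ z - μ' ⬝ᵥ μ' / 2) = Q
    have h3 : min P Q ≤ l * P + (1 - l) * Q := by
      nlinarith [mul_le_mul_of_nonneg_left (min_le_left P Q) hl0,
        mul_le_mul_of_nonneg_left (min_le_right P Q) (sub_nonneg.2 hl1)]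
    refine h3.trans_eq ?_
    rw [← hP, ← hQ, hm]
    simp only [add_dotProduct, dotProduct_add, smul_dotProduct, dotProduct_smul, sub_dotProduct,
      dotProduct_sub, smul_eq_mul, dotProduct_comm μ' μ]
    ring
  refine (integral_mono (((integrable_cmDens _).const_mul _).inf
    ((integrable_cmDens _).const_mul _)) ((integrable_cmDens _).const_mul _) key).trans_eq ?_
  rw [integral_const_mul, integral_cmDens, mul_one]

/-- A slab between the two shifts bounds the testing error from below. -/
lemma le_integral_min_cmDens (μ μ' : κ → ℝ) {a a' c B : ℝ} (ha : 0 < a) (ha' : 0 < a')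
    (hd : 0 < (μ' - μ) ⬝ᵥ (μ' - μ)) (hc : 0 ≤ c) (hB0 : 0 ≤ B) (hB : B ≤ a)
    (hB' : B ≤ a' * Real.exp (c * √((μ' - μ) ⬝ᵥ (μ' - μ)) - (μ' - μ) ⬝ᵥ (μ' - μ) / 2)) :
    B * ((√(2 * Real.pi))⁻¹ * Real.exp (-((c + 1) ^ 2 / 2))) ≤
      ∫ z, min (a * cmDens μ z) (a' * cmDens μ' z) ∂stdGauss κ := by
  set d := μ' - μ with hdd
  set T : Set (κ → ℝ) := {e | c * √(d ⬝ᵥ d) ≤ d ⬝ᵥ e ∧ d ⬝ᵥ e ≤ (c + 1) * √(d ⬝ᵥ d)} with hT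
  have hmd : Measurable fun e : κ → ℝ => d ⬝ᵥ e := by fun_prop
  have hTm : MeasurableSet T :=
    (measurableSet_le measurable_const hmd).inter (measurableSet_le hmd measurable_const)
  -- Factoring out the density of the shift by `μ` centres the experiment at `μ`. What remains is
  -- the likelihood ratio `exp (d·e - d·d / 2)`, which is bounded below on the slab.
  have h1 : ∀ z, min (a * cmDens μ z) (a' * cmDens μ' z) =
      min a (a' * Real.exp (d ⬝ᵥ z - d ⬝ᵥ μ - d ⬝ᵥ d / 2)) * cmDens μ z := by
    intro z
    rw [min_mul_of_nonneg _ _ (cmDens_pos _ _).le, mul_assoc a', cmDens, cmDens, ← Real.exp_add]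
    congr 3
    simp only [hdd, sub_dotProduct, dotProduct_sub, dotProduct_comm μ' μ]
    ring
  simp_rw [h1]
  rw [← integral_shift μ (fun z => min a (a' * Real.exp (d ⬝ᵥ z - d ⬝ᵥ μ - d ⬝ᵥ d / 2)))
    (by fun_prop)]
  simp only [dotProduct_add, add_sub_cancel_left]
  refine (mul_le_mul_of_nonneg_left (le_measureReal_dotProduct_slab d hd hc) hB0).trans ?_
  have h2 : Integrable (fun e => min a (a' * Real.exp (d ⬝ᵥ e - d ⬝ᵥ d / 2))) (stdGauss κ) :=
    (integrable_const a).inf ((integrable_cmDens d).const_mul a')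
  have h3 : ∫ e in T, B ∂stdGauss κ ≤
      ∫ e in T, min a (a' * Real.exp (d ⬝ᵥ e - d ⬝ᵥ d / 2)) ∂stdGauss κ := by
    refine setIntegral_mono_on (integrable_const B).integrableOn h2.integrableOn hTm fun e he => ?_
    refine le_min hB (hB'.trans ?_)
    have := he.1
    gcongr
  rw [setIntegral_const, smul_eq_mul, mul_comm] at h3
  exact h3.trans (setIntegral_le_integral h2 (Eventually.of_forall
    fun z => le_min ha.le (mul_pos ha' (Real.exp_pos _)).le))

/-- The minimum of two sums of positive terms is at most the sum of the pairwise minima. Together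
with `le_bayesErr_of_pair` this reduces the test between mixtures to four tests between simple
hypotheses, up to a factor 4. -/
lemma bayesErr_le_sum (h0 : 0 < ε) (h1 : ε < 1) :
    bayesErr ε M ≤ ∑ b : Bool, ∑ b' : Bool,
      ∫ z, min (spikeWeight ε false * spikeWeight ε b * cmDens (M false b) z)
        (spikeWeight ε true * spikeWeight ε b' * cmDens (M true b') z) ∂stdGauss κ := by
  have hi : ∀ b b', Integrable (fun z =>
      min (spikeWeight ε false * spikeWeight ε b * cmDens (M false b) z)
        (spikeWeight ε true * spikeWeight ε b' * cmDens (M true b') z)) (stdGauss κ) :=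
    fun b b' => ((integrable_cmDens _).const_mul _).inf ((integrable_cmDens _).const_mul _)
  simp_rw [← integral_finsetSum _ fun b' _ => hi _ b']
  rw [← integral_finsetSum _ fun b _ => integrable_finsetSum _ fun b' _ => hi b b']
  refine integral_mono integrable_min_margDens
    (integrable_finsetSum _ fun b _ => integrable_finsetSum _ fun b' _ => hi b b') fun z => ?_
  have hp : ∀ b b', 0 < spikeWeight ε b * spikeWeight ε b' * cmDens (M b b') z := fun b b' =>
    mul_pos (mul_pos (spikeWeight_pos h0 h1 b) (spikeWeight_pos h0 h1 b')) (cmDens_pos _ _)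
  simp only [margDens, Fintype.sum_bool]
  have := hp true true
  have := hp true false
  have := hp false true
  have := hp false false
  grind

lemma le_bayesErr_of_pair (h0 : 0 < ε) (h1 : ε < 1) (b b' : Bool) :
    ∫ z, min (spikeWeight ε false * spikeWeight ε b * cmDens (M false b) z)
        (spikeWeight ε true * spikeWeight ε b' * cmDens (M true b') z) ∂stdGauss κ ≤
      bayesErr ε M := by
  refine integral_mono (((integrable_cmDens _).const_mul _).inf ((integrable_cmDens _).const_mul _))
    integrable_min_margDens fun z => min_le_min ?_ ?_
  · exact Finset.single_le_sum (f := fun b' => spikeWeight ε false * spikeWeight ε b' *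
      cmDens (M false b') z) (fun b' _ => (mul_pos (mul_pos (spikeWeight_pos h0 h1 _)
      (spikeWeight_pos h0 h1 _)) (cmDens_pos _ _)).le) (Finset.mem_univ b)
  · exact Finset.single_le_sum (f := fun b' => spikeWeight ε true * spikeWeight ε b' *
      cmDens (M true b') z) (fun b' _ => (mul_pos (mul_pos (spikeWeight_pos h0 h1 _)
      (spikeWeight_pos h0 h1 _)) (cmDens_pos _ _)).le) (Finset.mem_univ b')

/-! ### The errors of the mirror statistics at one coefficient -/

/-- With `f`, `g` the two densities, a statistic of at least `log 2` means `f + g ≥ 2 f + 2 g exp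
(-2 η·z)`. Hence `g ≥ f`, and `f` is the minimum. -/
lemma mirrorLog_falsePos_le (h0 : 0 < ε) (h1 : ε < 1) (η : κ → ℝ) {t : ℝ} (ht : Real.log 2 ≤ t) :
    ∫ z in {z | t ≤ mirrorLog ε M η z}, margDens ε M false z ∂stdGauss κ ≤ bayesErr ε M := by
  have hS : MeasurableSet {z | t ≤ mirrorLog ε M η z} :=
    measurableSet_le measurable_const (measurable_mirrorLog η)
  refine (setIntegral_le_mul_bayesErr h0 h1 hS false (C := 1) (fun z hz => ?_) zero_le_one).trans_eq
    (one_mul _)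
  have hf := margDens_pos (M := M) h0 h1 false z
  have hg := margDens_pos (M := M) h0 h1 true z
  rw [one_mul]
  refine le_min le_rfl ?_
  have hz' : Real.log 2 ≤ mirrorLog ε M η z := ht.trans hz
  have hE := mul_pos hg (Real.exp_pos (-(2 * (η ⬝ᵥ z))))
  rw [mirrorLog, Real.log_le_log_iff two_pos (by positivity), le_div_iff₀ (by positivity)] at hz'
  linarith

/-- When `η·z` exceeds `(t + log 2) / 2`, one has `exp t * exp (-2 η·z) ≤ 1/2`. A statistic below
`t` then gives `f + g < exp t * f + g / 2`, so `g ≤ 2 exp t * f`. The complementary event is kept as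
the second term. -/
lemma mirrorLog_falseNeg_le (h0 : 0 < ε) (h1 : ε < 1) (η : κ → ℝ) (t : ℝ) (ht : 0 ≤ t) :
    ∫ z in {z | t ≤ mirrorLog ε M η z}ᶜ, margDens ε M true z ∂stdGauss κ ≤
      2 * Real.exp t * bayesErr ε M +
        ∫ z in {z | η ⬝ᵥ z ≤ (t + Real.log 2) / 2}, margDens ε M true z ∂stdGauss κ := by
  have hS : MeasurableSet {z | t ≤ mirrorLog ε M η z} :=
    measurableSet_le measurable_const (measurable_mirrorLog η)
  have hT : MeasurableSet {z | η ⬝ᵥ z ≤ (t + Real.log 2) / 2} :=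
    measurableSet_le (measurable_dotProduct η) measurable_const
  set T := {z | η ⬝ᵥ z ≤ (t + Real.log 2) / 2} with hTd
  set S := {z | t ≤ mirrorLog ε M η z}ᶜ with hSd
  have hsub : S ⊆ (S \ T) ∪ T := fun z hz => by
    by_cases h : z ∈ T
    · exact Or.inr h
    · exact Or.inl ⟨hz, h⟩
  refine (setIntegral_mono_set (integrable_margDens true).integrableOn
    (Eventually.of_forall fun z => (margDens_pos h0 h1 true z).le)
    (LE.le.eventuallyLE hsub)).trans ?_
  rw [setIntegral_union Set.disjoint_sdiff_left hT (integrable_margDens true).integrableOn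
    (integrable_margDens true).integrableOn]
  refine add_le_add_left (setIntegral_le_mul_bayesErr h0 h1 (hS.compl.diff hT) true
    (fun z hz => ?_) (by positivity)) _
  have hf := margDens_pos (M := M) h0 h1 false z
  have hg := margDens_pos (M := M) h0 h1 true z
  have hE := mul_pos hg (Real.exp_pos (-(2 * (η ⬝ᵥ z))))
  have het : 1 ≤ Real.exp t := Real.one_le_exp ht
  have hz1 : mirrorLog ε M η z < t := not_le.1 hz.1
  have hz2 : (t + Real.log 2) / 2 < η ⬝ᵥ z := not_le.1 hz.2
  rw [mirrorLog, Real.log_lt_iff_lt_exp (by positivity), div_lt_iff₀ (by positivity)] at hz1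
  have h3 : Real.exp t * Real.exp (-(2 * (η ⬝ᵥ z))) ≤ 1 / 2 := by
    rw [← Real.exp_add, one_div, ← Real.exp_log two_pos, ← Real.exp_neg, Real.exp_le_exp,
      Real.exp_log two_pos]
    linarith
  have h4 : margDens ε M true z ≤ 2 * Real.exp t * margDens ε M false z := by
    nlinarith [mul_le_mul_of_nonneg_right h3 hg.le]
  rw [mul_min_of_nonneg _ _ (by positivity)]
  exact le_min h4 (by nlinarith)

/-- By `hη` the partner does not affect the mean in direction `η`, so the two partner states have
the same probability and their weights add up to `ε`. -/
lemma setIntegral_dotProduct_le (η : κ → ℝ) (hη : ∀ b', η ⬝ᵥ M true b' = η ⬝ᵥ η) (y : ℝ) :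
    ∫ z in {z | η ⬝ᵥ z ≤ y}, margDens ε M true z ∂stdGauss κ =
      ε * (stdGauss κ).real {e | η ⬝ᵥ e ≤ y - η ⬝ᵥ η} := by
  rw [setIntegral_margDens true (measurableSet_le (measurable_dotProduct η) measurable_const)]
  have h : ∀ b', {e | M true b' + e ∈ {z | η ⬝ᵥ z ≤ y}} = {e | η ⬝ᵥ e ≤ y - η ⬝ᵥ η} := by
    intro b'
    ext e
    change η ⬝ᵥ (M true b' + e) ≤ y ↔ η ⬝ᵥ e ≤ y - η ⬝ᵥ η
    rw [dotProduct_add, hη, le_sub_iff_add_le']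
  simp only [h, Fintype.sum_bool, spikeWeight, cond_true, cond_false]
  ring

lemma setIntegral_dotProduct_le_exp (h0 : 0 < ε) (η : κ → ℝ)
    (hη : ∀ b', η ⬝ᵥ M true b' = η ⬝ᵥ η) (hη0 : 0 < η ⬝ᵥ η) {y : ℝ} (hy : y ≤ η ⬝ᵥ η) :
    ∫ z in {z | η ⬝ᵥ z ≤ y}, margDens ε M true z ∂stdGauss κ ≤
      ε * Real.exp (-((y - η ⬝ᵥ η) ^ 2 / (2 * (η ⬝ᵥ η)))) := by
  rw [setIntegral_dotProduct_le η hη]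
  exact mul_le_mul_of_nonneg_left (measureReal_dotProduct_le η hη0 (by linarith)) h0.le

/-- For `η·z ≤ 0` the reflected predictive density is at least the original one, so the statistic is
nonpositive and a spike is missed at every positive threshold. No choice of `t` avoids this cost. -/
lemma le_mirrorLog_falseNeg (h0 : 0 < ε) (h1 : ε < 1) (η : κ → ℝ)
    (hη : ∀ b', η ⬝ᵥ M true b' = η ⬝ᵥ η) (hη0 : 0 < η ⬝ᵥ η) {t : ℝ} (ht : 0 < t) :
    ε * ((√(2 * Real.pi))⁻¹ * Real.exp (-((√(η ⬝ᵥ η) + 1) ^ 2 / 2))) ≤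
      ∫ z in {z | t ≤ mirrorLog ε M η z}ᶜ, margDens ε M true z ∂stdGauss κ := by
  have hsub : {z | η ⬝ᵥ z ≤ 0} ⊆ {z | t ≤ mirrorLog ε M η z}ᶜ := by
    intro z hz hz'
    have hz0 : η ⬝ᵥ z ≤ 0 := hz
    have hf := margDens_pos (M := M) h0 h1 false z
    have hg := margDens_pos (M := M) h0 h1 true z
    have h3 : mirrorLog ε M η z ≤ 0 := by
      have : 1 ≤ Real.exp (-(2 * (η ⬝ᵥ z))) := Real.one_le_exp (by linarith)
      refine Real.log_nonpos (by positivity) ((div_le_one (by positivity)).2 ?_)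
      nlinarith
    exact absurd (le_trans hz' h3) (not_le.2 ht)
  refine le_trans ?_ (setIntegral_mono_set (integrable_margDens true).integrableOn
    (Eventually.of_forall fun z => (margDens_pos h0 h1 true z).le)
    (LE.le.eventuallyLE hsub))
  rw [setIntegral_dotProduct_le η hη]
  refine mul_le_mul_of_nonneg_left ?_ h0.le
  have hn : (-η) ⬝ᵥ (-η) = η ⬝ᵥ η := by simp
  -- With `c = √(η·η)` the slab begins where `-η·e = η·η`, exactly enough noise to cancel the mean
  -- of the spike.
  have h := le_measureReal_dotProduct_slab (-η) (by rwa [hn]) (Real.sqrt_nonneg (η ⬝ᵥ η))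
  rw [hn] at h
  refine h.trans (measureReal_mono fun e he => ?_)
  have := he.1
  rw [Real.mul_self_sqrt hη0.le, neg_dotProduct] at this
  change η ⬝ᵥ e ≤ 0 - η ⬝ᵥ η
  linarith

end Testing

/-! ### Chernoff exponents -/

/-- The Chernoff exponent with weight `l` for testing two hypotheses with prior exponents `α`, `α'`
and squared distance exponent `Δ`. -/
def chernoffExp (l α α' Δ : ℝ) : ℝ := l * α + (1 - l) * α' + l * (1 - l) * Δ

/-- The weight that maximizes the Chernoff exponent. -/
def optWeight (α α' Δ : ℝ) : ℝ := max 0 (min 1 ((1 - (α' - α) / Δ) / 2))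

/-- The exponent of the Bayes error for testing two hypotheses. -/
def pairExp (α α' Δ : ℝ) : ℝ := chernoffExp (optWeight α α' Δ) α α' Δ

/-- The exponent of the prior probability of the state `(b, b')`. -/
def stateExp (ϑ : ℝ) (b b' : Bool) : ℝ := (bif b then ϑ else 0) + bif b' then ϑ else 0

/-- The exponent of the Bayes error for deciding whether the coefficient of interest is a spike. -/
def bayesExp (ϑ : ℝ) (Δ : Bool → Bool → ℝ) : ℝ :=
  ⨅ b : Bool × Bool, pairExp (stateExp ϑ false b.1) (stateExp ϑ true b.2) (Δ b.1 b.2)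

lemma optWeight_nonneg (α α' Δ : ℝ) : 0 ≤ optWeight α α' Δ := le_max_left _ _

lemma optWeight_le_one (α α' Δ : ℝ) : optWeight α α' Δ ≤ 1 :=
  max_le zero_le_one (min_le_left _ _)

/-- The left sides are the costs, under each hypothesis, of the point that divides the segment
between the means in the ratio `1 - l : l`. At an interior optimum stationarity makes both equal to
the value; at an endpoint one of them has slack. The slab lower bound needs exactly these
inequalities. -/
lemma pairExp_saddle (α α' : ℝ) {Δ : ℝ} (hΔ : 0 < Δ) :
    α + (1 - optWeight α α' Δ) ^ 2 * Δ ≤ pairExp α α' Δ ∧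
      α' + optWeight α α' Δ ^ 2 * Δ ≤ pairExp α α' Δ := by
  unfold pairExp chernoffExp
  have hx : (α' - α) / Δ * Δ = α' - α := div_mul_cancel₀ _ hΔ.ne'
  set x := (α' - α) / Δ with hxd
  have hα : α' = α + x * Δ := by linarith
  rcases le_total x (-1) with h1 | h1
  · have : optWeight α α' Δ = 1 := by
      rw [optWeight, ← hxd, min_eq_left (by linarith), max_eq_right zero_le_one]
    rw [this, hα]
    constructor <;> nlinarith
  rcases le_total x 1 with h2 | h2
  · have : optWeight α α' Δ = (1 - x) / 2 := by
      rw [optWeight, ← hxd, min_eq_right (by linarith), max_eq_right (by linarith)]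
    rw [this, hα]
    constructor <;> apply le_of_eq <;> ring
  · have : optWeight α α' Δ = 0 := by
      rw [optWeight, ← hxd, min_eq_right (by linarith), max_eq_left (by linarith)]
    rw [this, hα]
    constructor <;> nlinarith

/-- Averaging the saddle inequalities with weights `l` and `1 - l` gives `chernoffExp l + (l - l⋆)²
Δ ≤ pairExp`, with `l⋆` the optimal weight. -/
lemma chernoffExp_le_pairExp {l : ℝ} (hl0 : 0 ≤ l) (hl1 : l ≤ 1) (α α' : ℝ) {Δ : ℝ} (hΔ : 0 < Δ) :
    chernoffExp l α α' Δ ≤ pairExp α α' Δ := by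
  obtain ⟨h1, h2⟩ := pairExp_saddle α α' hΔ
  have h3 := mul_le_mul_of_nonneg_left h1 hl0
  have h4 := mul_le_mul_of_nonneg_left h2 (sub_nonneg.2 hl1)
  have h5 := mul_nonneg (sq_nonneg (l - optWeight α α' Δ)) hΔ.le
  unfold chernoffExp
  nlinarith

/-- The optimal weight of the smaller parameters is still admissible for the larger ones, and the
exponent at a fixed weight is monotone. -/
lemma pairExp_mono {α α' β β' Δ Δ' : ℝ} (hα : α ≤ β) (hα' : α' ≤ β') (hΔ : 0 < Δ) (hΔ' : Δ ≤ Δ') :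
    pairExp α α' Δ ≤ pairExp β β' Δ' := by
  have h0 := optWeight_nonneg α α' Δ
  have h1 := optWeight_le_one α α' Δ
  refine le_trans ?_ (chernoffExp_le_pairExp h0 h1 β β' (hΔ.trans_le hΔ'))
  unfold pairExp chernoffExp
  have := mul_nonneg h0 (sub_nonneg.2 h1)
  have := sub_nonneg.2 h1
  gcongr

/-- For `Δ ≤ ϑ` the optimal weight is 0 and the exponent is that of missing all spikes; otherwise
the weight is `(1 - ϑ / Δ) / 2`. -/
lemma pairExp_zero_left {ϑ Δ : ℝ} (hϑ : 0 ≤ ϑ) (hΔ : 0 < Δ) :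
    pairExp 0 ϑ Δ = ϑ + (max (Δ - ϑ) 0) ^ 2 / (4 * Δ) := by
  unfold pairExp chernoffExp
  rcases le_total Δ ϑ with h | h
  · have : optWeight 0 ϑ Δ = 0 := by
      have : 1 ≤ (ϑ - 0) / Δ := by rw [one_le_div hΔ]; linarith
      rw [optWeight, max_eq_left ((min_le_right _ _).trans (by linarith))]
    rw [this, max_eq_right (by linarith)]
    ring
  · have : optWeight 0 ϑ Δ = (1 - ϑ / Δ) / 2 := by
      have h1 : ϑ / Δ ≤ 1 := (div_le_one hΔ).2 h
      have h2 : 0 ≤ ϑ / Δ := by positivity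
      rw [optWeight, sub_zero, min_eq_right (by linarith), max_eq_right (by linarith)]
    rw [this, max_eq_left (by linarith)]
    field_simp
    ring

lemma bayesExp_le (ϑ : ℝ) (Δ : Bool → Bool → ℝ) (b b' : Bool) :
    bayesExp ϑ Δ ≤ pairExp (stateExp ϑ false b) (stateExp ϑ true b') (Δ b b') :=
  ciInf_le (Set.finite_range _).bddBelow (b, b')

lemma le_bayesExp {ϑ : ℝ} {Δ : Bool → Bool → ℝ} {c : ℝ}
    (h : ∀ b b', c ≤ pairExp (stateExp ϑ false b) (stateExp ϑ true b') (Δ b b')) :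
    c ≤ bayesExp ϑ Δ :=
  le_ciInf fun b => h b.1 b.2

/-- With a common distance, a spike at the partner only raises the prior exponents, so the pair
without one is the worst. -/
lemma bayesExp_const {ϑ Δ : ℝ} (hϑ : 0 ≤ ϑ) (hΔ : 0 < Δ) :
    bayesExp ϑ (fun _ _ => Δ) = ϑ + (max (Δ - ϑ) 0) ^ 2 / (4 * Δ) := by
  rw [← pairExp_zero_left hϑ hΔ]
  refine le_antisymm ?_ (le_bayesExp fun b b' => pairExp_mono ?_ ?_ hΔ le_rfl)
  · simpa [stateExp] using bayesExp_le ϑ (fun _ _ => Δ) false false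
  · cases b <;> simp [stateExp, hϑ]
  · cases b' <;> simp [stateExp, hϑ]

/-! ### The Bayes error in the calibrated experiment -/

section Calibrated

variable {κ : Type} [Fintype κ] {ε ϑ L : ℝ} {M : Bool → Bool → κ → ℝ} {Δ : Bool → Bool → ℝ}

lemma spikeWeight_le_exp (hε : ε = Real.exp (-(ϑ * L))) (b : Bool) :
    spikeWeight ε b ≤ Real.exp (-((bif b then ϑ else 0) * L)) := by
  cases b
  · simp [spikeWeight, hε, Real.exp_nonneg]
  · simp [spikeWeight, hε]

lemma half_exp_le_spikeWeight (hε : ε = Real.exp (-(ϑ * L))) (h2 : ε ≤ 1 / 2) (b : Bool) :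
    1 / 2 * Real.exp (-((bif b then ϑ else 0) * L)) ≤ spikeWeight ε b := by
  cases b
  · simp only [spikeWeight, cond_false]; norm_num; linarith
  · simp only [spikeWeight, cond_true, hε]; linarith [Real.exp_pos (-(ϑ * L))]

lemma weights_le_exp (h0 : 0 < ε) (h1 : ε < 1) (hε : ε = Real.exp (-(ϑ * L))) (b b' : Bool) :
    spikeWeight ε b * spikeWeight ε b' ≤ Real.exp (-(stateExp ϑ b b' * L)) := by
  rw [stateExp, add_mul, neg_add, Real.exp_add]
  exact mul_le_mul (spikeWeight_le_exp hε b) (spikeWeight_le_exp hε b')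
    (spikeWeight_pos h0 h1 b').le (Real.exp_pos _).le

lemma exp_le_weights (h0 : 0 < ε) (hε : ε = Real.exp (-(ϑ * L))) (h2 : ε ≤ 1 / 2) (b b' : Bool) :
    1 / 4 * Real.exp (-(stateExp ϑ b b' * L)) ≤ spikeWeight ε b * spikeWeight ε b' := by
  rw [stateExp, add_mul, neg_add, Real.exp_add]
  refine le_trans (le_of_eq (by ring)) (mul_le_mul (half_exp_le_spikeWeight hε h2 b)
    (half_exp_le_spikeWeight hε h2 b') (by positivity)
    (spikeWeight_pos h0 (by linarith) b).le)

lemma bayesErr_le_exp (h0 : 0 < ε) (h1 : ε < 1) (hε : ε = Real.exp (-(ϑ * L))) (hL : 0 ≤ L)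
    (hM : ∀ b b', (M true b' - M false b) ⬝ᵥ (M true b' - M false b) = 2 * Δ b b' * L) :
    bayesErr ε M ≤ 4 * Real.exp (-(bayesExp ϑ Δ * L)) := by
  refine (bayesErr_le_sum h0 h1).trans ?_
  have h : ∀ b b',
      ∫ z, min (spikeWeight ε false * spikeWeight ε b * cmDens (M false b) z)
        (spikeWeight ε true * spikeWeight ε b' * cmDens (M true b') z) ∂stdGauss κ ≤
      Real.exp (-(bayesExp ϑ Δ * L)) := by
    intro b b'
    refine (integral_min_cmDens_le (M false b) (M true b') (weights_le_exp h0 h1 hε false b)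
      (weights_le_exp h0 h1 hε true b') (optWeight_nonneg (stateExp ϑ false b) (stateExp ϑ true b') (Δ b b'))
      (optWeight_le_one _ _ _)).trans ?_
    rw [Real.exp_le_exp, neg_le_neg_iff, hM]
    refine (mul_le_mul_of_nonneg_right (bayesExp_le ϑ Δ b b') hL).trans_eq ?_
    unfold pairExp chernoffExp
    ring
  simp only [Fintype.sum_bool]
  linarith [h true true, h true false, h false true, h false false]

/-- The Bayes error attains its exponent up to a factor `exp (-C (√L + 1))`. -/
lemma exists_exp_le_bayesErr (ϑ : ℝ) (Δ : Bool → Bool → ℝ) (hΔ : ∀ b b', 0 < Δ b b') :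
    ∃ C : ℝ, ∀ (κ : Type) [Fintype κ] (ε L : ℝ) (M : Bool → Bool → κ → ℝ), 0 < L →
      ε = Real.exp (-(ϑ * L)) → ε ≤ 1 / 2 →
      (∀ b b', (M true b' - M false b) ⬝ᵥ (M true b' - M false b) = 2 * Δ b b' * L) →
      Real.exp (-(bayesExp ϑ Δ * L + C * (√L + 1))) ≤ bayesErr ε M := by
  obtain ⟨⟨b, b'⟩, hb⟩ := exists_eq_ciInf_of_finite (f := fun b : Bool × Bool =>
    pairExp (stateExp ϑ false b.1) (stateExp ϑ true b.2) (Δ b.1 b.2))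
  change pairExp (stateExp ϑ false b) (stateExp ϑ true b') (Δ b b') = bayesExp ϑ Δ at hb
  set D := Δ b b' with hD
  have hD0 : 0 < D := hΔ b b'
  set l := optWeight (stateExp ϑ false b) (stateExp ϑ true b') D with hl
  have hl0 : 0 ≤ l := optWeight_nonneg _ _ _
  have hl1 : 0 ≤ 1 - l := sub_nonneg.2 (optWeight_le_one _ _ _)
  obtain ⟨hs1, hs2⟩ := pairExp_saddle (stateExp ϑ false b) (stateExp ϑ true b') hD0
  rw [hb] at hs1 hs2
  have hpi : 0 < (√(2 * Real.pi))⁻¹ := inv_pos.2 (Real.sqrt_pos.2 (by positivity))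
  -- `C2` absorbs the constants `1/4`, `(2π)^(-1/2)` and `exp (-1/2)`. The other part of the final
  -- constant, `(1 - l) √(2D)`, is the cross term in `((1 - l) S + 1)² / 2`.
  set C2 := |Real.log (1 / 4 * (√(2 * Real.pi))⁻¹)| + 1 / 2 with hC2
  have hC2e : Real.exp (-C2) ≤ 1 / 4 * (√(2 * Real.pi))⁻¹ * Real.exp (-(1 / 2)) := by
    have h : 0 < 1 / 4 * (√(2 * Real.pi))⁻¹ := by positivity
    rw [← Real.exp_log h, ← Real.exp_add, Real.exp_le_exp, hC2]
    linarith [neg_abs_le (Real.log (1 / 4 * (√(2 * Real.pi))⁻¹))]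
  have hC20 : 0 ≤ C2 := by positivity
  refine ⟨(1 - l) * √(2 * D) + C2, fun κ _ ε L M hL hε h2 hM => ?_⟩
  have h0 : 0 < ε := hε ▸ Real.exp_pos _
  have h1 : ε < 1 := by linarith
  refine le_trans ?_ (le_bayesErr_of_pair h0 h1 b b')
  set S := √(2 * D * L) with hSd
  have hS2 : S * S = 2 * D * L := Real.mul_self_sqrt (by positivity)
  have hS0 : 0 ≤ S := Real.sqrt_nonneg _
  -- The slab sits at the fraction `1 - l` of the way between the two means. Its probability is
  -- about `exp (-(1 - l)² D L)`, and `B` is chosen so that the product has exponent `bayesExp`; the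
  -- two bounds on `B` are the saddle inequalities.
  have key := le_integral_min_cmDens (M false b) (M true b')
    (a := spikeWeight ε false * spikeWeight ε b) (a' := spikeWeight ε true * spikeWeight ε b')
    (c := (1 - l) * S) (B := 1 / 4 * Real.exp (-(bayesExp ϑ Δ * L - (1 - l) ^ 2 * D * L)))
    (mul_pos (spikeWeight_pos h0 h1 _) (spikeWeight_pos h0 h1 _))
    (mul_pos (spikeWeight_pos h0 h1 _) (spikeWeight_pos h0 h1 _))
    (by rw [hM]; positivity) (by positivity) (by positivity) ?_ ?_
  · refine le_trans ?_ key
    have hexp : Real.exp (-(((1 - l) * S + 1) ^ 2 / 2)) =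
        Real.exp (-((1 - l) ^ 2 * D * L)) * Real.exp (-((1 - l) * S)) * Real.exp (-(1 / 2)) := by
      rw [← Real.exp_add, ← Real.exp_add]
      congr 1
      have : S ^ 2 = 2 * D * L := by rw [sq, hS2]
      linear_combination (-(1 - l) ^ 2 / 2) * this
    have hSL : S = √(2 * D) * √L := Real.sqrt_mul (by positivity) _
    have e1 : Real.exp (-(bayesExp ϑ Δ * L + ((1 - l) * √(2 * D) + C2) * (√L + 1))) ≤
        Real.exp (-(bayesExp ϑ Δ * L)) * Real.exp (-((1 - l) * S)) * Real.exp (-C2) := by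
      rw [← Real.exp_add, ← Real.exp_add, Real.exp_le_exp, hSL]
      nlinarith [mul_nonneg hC20 (Real.sqrt_nonneg L), mul_nonneg hl1 (Real.sqrt_nonneg (2 * D))]
    refine e1.trans ((mul_le_mul_of_nonneg_left hC2e (by positivity)).trans_eq ?_)
    have e2 : Real.exp (-(bayesExp ϑ Δ * L)) =
        Real.exp (-(bayesExp ϑ Δ * L - (1 - l) ^ 2 * D * L)) *
          Real.exp (-((1 - l) ^ 2 * D * L)) := by
      rw [← Real.exp_add]; congr 1; ring
    rw [hexp, e2]
    ring
  · refine le_trans ?_ (exp_le_weights h0 hε h2 false b)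
    gcongr
    nlinarith [mul_le_mul_of_nonneg_right hs1 hL.le]
  · refine le_trans ?_ (mul_le_mul_of_nonneg_right (exp_le_weights h0 hε h2 true b')
      (Real.exp_pos _).le)
    rw [mul_assoc (1 / 4), ← Real.exp_add, hM]
    gcongr
    have : (1 - l) * S * S = (1 - l) * (2 * D * L) := by rw [mul_assoc, hS2]
    rw [← hSd, this]
    nlinarith [mul_le_mul_of_nonneg_right hs2 hL.le]

/-- The log-likelihood-ratio mirror statistic at a small threshold has the error exponent
`min (bayesExp ϑ Δ) (ϑ + a)`. -/
lemma exists_mirrorLog_error_le (ϑ : ℝ) (Δ : Bool → Bool → ℝ) {a δ : ℝ} (ha : 0 < a) (hδ : 0 < δ) :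
    ∃ u : ℝ, 0 < u ∧ ∃ L₀ : ℝ, ∀ (κ : Type) [Fintype κ] (ε L : ℝ) (M : Bool → Bool → κ → ℝ)
      (η : κ → ℝ), L₀ ≤ L → ε = Real.exp (-(ϑ * L)) → ε < 1 →
      (∀ b b', (M true b' - M false b) ⬝ᵥ (M true b' - M false b) = 2 * Δ b b' * L) →
      (∀ b', η ⬝ᵥ M true b' = η ⬝ᵥ η) → η ⬝ᵥ η = 2 * a * L →
      ∫ z in {z | 2 * u * L ≤ mirrorLog ε M η z}, margDens ε M false z ∂stdGauss κ +
        ∫ z in {z | 2 * u * L ≤ mirrorLog ε M η z}ᶜ, margDens ε M true z ∂stdGauss κ ≤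
      Real.exp (-((min (bayesExp ϑ Δ) (ϑ + a) - δ) * L)) := by
  -- `u ≤ δ / 4` makes the loss `exp (2 u L)` at most `p ^ (δ / 2)`, leaving `δ / 2` for constants;
  -- `u ≤ a` keeps the cut for `η·z` below its mean `2 a L`. The bound `L₀` ensures a threshold of
  -- at least `log 2` and absorbs the factor 13.
  set u := min (δ / 4) a with hu
  have hu0 : 0 < u := lt_min (by positivity) ha
  have hua : u ≤ a := min_le_right _ _
  have huδ : u ≤ δ / 4 := min_le_left _ _
  refine ⟨u, hu0, max (Real.log 2 / (2 * u)) (Real.log 13 / (δ / 2)),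
    fun κ _ ε L M η hL hε h1 hM hη hηη => ?_⟩
  have hl2 : 0 < Real.log 2 := Real.log_pos (by norm_num)
  have hL1 : Real.log 2 ≤ 2 * u * L := by
    have := (le_max_left _ _).trans hL
    rw [div_le_iff₀ (by positivity)] at this
    linarith
  have hL2 : Real.log 13 ≤ δ / 2 * L := by
    have := (le_max_right _ _).trans hL
    rw [div_le_iff₀ (by positivity)] at this
    linarith
  have hL0 : 0 < L := by
    by_contra h
    nlinarith
  have h0 : 0 < ε := hε ▸ Real.exp_pos _
  have hB := bayesErr_le_exp h0 h1 hε hL0.le hM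
  have hy : (2 * u * L + Real.log 2) / 2 ≤ 2 * u * L := by linarith
  have hF := mirrorLog_falsePos_le (M := M) h0 h1 η hL1
  have hG := mirrorLog_falseNeg_le (M := M) h0 h1 η (2 * u * L) (by positivity)
  have hyη : (2 * u * L + Real.log 2) / 2 ≤ η ⬝ᵥ η := by
    rw [hηη]; exact hy.trans (by gcongr)
  have hT := setIntegral_dotProduct_le_exp h0 η hη (by rw [hηη]; positivity) hyη
  set E := min (bayesExp ϑ Δ) (ϑ + a) with hE
  have hE1 : E ≤ bayesExp ϑ Δ := min_le_left _ _
  have hE2 : E ≤ ϑ + a := min_le_right _ _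
  have hb1 : Real.exp (-(bayesExp ϑ Δ * L)) ≤ Real.exp (-(E * L)) :=
    Real.exp_le_exp.2 (neg_le_neg (mul_le_mul_of_nonneg_right hE1 hL0.le))
  have hT2 : ε * Real.exp (-(((2 * u * L + Real.log 2) / 2 - η ⬝ᵥ η) ^ 2 / (2 * (η ⬝ᵥ η)))) ≤
      Real.exp (2 * u * L) * Real.exp (-(E * L)) := by
    rw [hε, ← Real.exp_add, ← Real.exp_add, Real.exp_le_exp, hηη]
    -- The exponent is at least `(a - u)² L / a`, and `(a - u)² ≥ a (a - 2 u)`.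
    have h3 : (a - 2 * u) * L ≤
        ((2 * u * L + Real.log 2) / 2 - 2 * a * L) ^ 2 / (2 * (2 * a * L)) := by
      rw [le_div_iff₀ (by positivity)]
      have h4 : (2 * a * L - 2 * u * L) ^ 2 ≤
          ((2 * u * L + Real.log 2) / 2 - 2 * a * L) ^ 2 := by
        rw [← sq_abs ((2 * u * L + Real.log 2) / 2 - 2 * a * L), abs_sub_comm]
        refine pow_le_pow_left₀ ?_ ((by linarith : _ ≤ _).trans (le_abs_self _)) 2
        nlinarith
      nlinarith [sq_nonneg (u * L)]
    nlinarith [mul_le_mul_of_nonneg_right hE2 hL0.le]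
  have he1 : 1 ≤ Real.exp (2 * u * L) := Real.one_le_exp (by positivity)
  have hEp := Real.exp_pos (-(E * L))
  -- The constant is `13 = 4 + 2 · 4 + 1`: false positives, misses charged to the Bayes error, and
  -- misses by a small projection.
  have htot : Real.exp (-(E * L)) * 4 + 2 * Real.exp (2 * u * L) * (4 * Real.exp (-(E * L))) +
      Real.exp (2 * u * L) * Real.exp (-(E * L)) ≤
      13 * (Real.exp (2 * u * L) * Real.exp (-(E * L))) := by nlinarith
  have hfin : 13 * (Real.exp (2 * u * L) * Real.exp (-(E * L))) ≤
      Real.exp (-((E - δ) * L)) := by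
    rw [← Real.exp_add, ← Real.exp_log (by norm_num : (0 : ℝ) < 13), ← Real.exp_add,
      Real.exp_le_exp]
    nlinarith
  refine le_trans ?_ (htot.trans hfin)
  have hBE : bayesErr ε M ≤ 4 * Real.exp (-(E * L)) := by linarith
  have := mul_le_mul_of_nonneg_left hBE (by positivity : 0 ≤ 2 * Real.exp (2 * u * L))
  linarith

end Calibrated

/-! ### The spike-and-slab prior as a finite mixture of point masses -/

/-- The value of a coefficient that is a spike (`true`) or not (`false`). -/
def spikeVal (τ : ℝ) (b : Bool) : ℝ := bif b then τ else 0

section Prior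

variable {ε τ : ℝ}

lemma spikeSlab_eq_sum (ε τ : ℝ) :
    spikeSlab ε τ = ∑ b : Bool, ENNReal.ofReal (spikeWeight ε b) • Measure.dirac (spikeVal τ b) := by
  simp [spikeSlab, spikeWeight, spikeVal, add_comm]

lemma isProbabilityMeasure_spikeSlab (h0 : 0 < ε) (h1 : ε < 1) :
    IsProbabilityMeasure (spikeSlab ε τ) := by
  refine ⟨?_⟩
  simp only [spikeSlab, Measure.coe_add, Measure.coe_smul, Pi.add_apply, Pi.smul_apply,
    measure_univ, smul_eq_mul, mul_one]
  rw [← ENNReal.ofReal_add (by linarith) h0.le]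
  simp

lemma isProbabilityMeasure_coefPrior (ι : Type) [Fintype ι] (h0 : 0 < ε) (h1 : ε < 1) :
    IsProbabilityMeasure (coefPrior ι ε τ) := by
  have := isProbabilityMeasure_spikeSlab (τ := τ) h0 h1
  unfold coefPrior
  infer_instance

/-- As a finite mixture of atoms the prior makes every function integrable, so positivity and
finiteness of the normalizing constants need no measurability. -/
lemma coefPrior_eq_sum (ι : Type) [Fintype ι] [DecidableEq ι] (h0 : 0 < ε) (h1 : ε < 1) :
    coefPrior ι ε τ = ∑ T : ι → Bool, (∏ i, ENNReal.ofReal (spikeWeight ε (T i))) •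
      Measure.dirac fun i => spikeVal τ (T i) := by
  have := isProbabilityMeasure_spikeSlab (τ := τ) h0 h1
  refine Measure.pi_eq fun s hs => ?_
  simp only [Measure.coe_finsetSum, Finset.sum_apply, Measure.coe_smul, Pi.smul_apply,
    spikeSlab_eq_sum, Measure.dirac_apply' _ (MeasurableSet.univ_pi hs), smul_eq_mul,
    Measure.dirac_apply' _ (hs _)]
  rw [Finset.prod_univ_sum, Fintype.piFinset_univ]
  refine Finset.sum_congr rfl fun T _ => ?_
  rw [Finset.prod_mul_distrib]
  congr 1
  by_cases hT : (fun i => spikeVal τ (T i)) ∈ Set.univ.pi s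
  · rw [Set.indicator_of_mem hT, Finset.prod_eq_one fun i _ =>
      Set.indicator_of_mem (hT i (Set.mem_univ i)) _]
    rfl
  · rw [Set.indicator_of_notMem hT]
    simp only [Set.mem_pi, Set.mem_univ, true_implies, not_forall] at hT
    obtain ⟨i, hi⟩ := hT
    exact (Finset.prod_eq_zero (Finset.mem_univ i) (Set.indicator_of_notMem hi _)).symm

lemma prod_ofReal_spikeWeight_ne {ι : Type} [Fintype ι] (h0 : 0 < ε) (h1 : ε < 1) (T : ι → Bool) :
    (∏ i, ENNReal.ofReal (spikeWeight ε (T i))) ≠ 0 ∧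
      (∏ i, ENNReal.ofReal (spikeWeight ε (T i))) ≠ ∞ :=
  ⟨Finset.prod_ne_zero_iff.2 fun _ _ => (ENNReal.ofReal_pos.2 (spikeWeight_pos h0 h1 _)).ne',
    ENNReal.prod_ne_top fun _ _ => ENNReal.ofReal_ne_top⟩

lemma integrable_coefPrior {ι : Type} [Fintype ι] (h0 : 0 < ε) (h1 : ε < 1) (F : (ι → ℝ) → ℝ) :
    Integrable F (coefPrior ι ε τ) := by
  classical
  rw [coefPrior_eq_sum ι h0 h1, integrable_finsetSum_measure]
  exact fun T _ => (integrable_dirac (by simp)).smul_measure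
    (prod_ofReal_spikeWeight_ne h0 h1 T).2

lemma integral_coefPrior_pos {ι : Type} [Fintype ι] (h0 : 0 < ε) (h1 : ε < 1) (F : (ι → ℝ) → ℝ)
    (hF : ∀ β, 0 < F β) : 0 < ∫ β, F β ∂coefPrior ι ε τ := by
  have := isProbabilityMeasure_coefPrior (τ := τ) ι h0 h1
  rw [integral_pos_iff_support_of_nonneg (fun β => (hF β).le) (integrable_coefPrior h0 h1 F)]
  have : Function.support F = Set.univ := Set.eq_univ_of_forall fun β => (hF β).ne'
  simp [this]

lemma lintegral_coefPrior_ne {ι : Type} [Fintype ι] (h0 : 0 < ε) (h1 : ε < 1)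
    (F : (ι → ℝ) → ℝ≥0∞) (hF : ∀ β, F β ≠ 0) (hF' : ∀ β, F β ≠ ∞) :
    ∫⁻ β, F β ∂coefPrior ι ε τ ≠ 0 ∧ ∫⁻ β, F β ∂coefPrior ι ε τ ≠ ∞ := by
  classical
  have h : ∫⁻ β, F β ∂coefPrior ι ε τ = ∑ T : ι → Bool,
      (∏ i, ENNReal.ofReal (spikeWeight ε (T i))) * F fun i => spikeVal τ (T i) := by
    rw [coefPrior_eq_sum ι h0 h1, lintegral_finsetSum_measure]
    simp [lintegral_smul_measure, lintegral_dirac]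
  rw [h]
  constructor
  · intro h0s
    exact mul_ne_zero (prod_ofReal_spikeWeight_ne h0 h1 _).1 (hF _)
      (Finset.sum_eq_zero_iff.1 h0s (fun _ => false) (Finset.mem_univ _))
  · exact ENNReal.sum_ne_top.2 fun T _ =>
      ENNReal.mul_ne_top (prod_ofReal_spikeWeight_ne h0 h1 _).2 (hF' _)

lemma integral_spikeSlab (h0 : 0 < ε) (h1 : ε < 1) (F : ℝ → ℝ) :
    ∫ x, F x ∂spikeSlab ε τ = ∑ b : Bool, spikeWeight ε b * F (spikeVal τ b) := by
  have hi : ∀ b, Integrable F (ENNReal.ofReal (spikeWeight ε b) • Measure.dirac (spikeVal τ b)) :=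
    fun b => (integrable_dirac (by simp)).smul_measure ENNReal.ofReal_ne_top
  rw [spikeSlab_eq_sum, integral_finsetSum_measure fun b _ => hi b]
  simp [integral_smul_measure, ENNReal.toReal_ofReal (spikeWeight_pos h0 h1 _).le]

lemma integral_spikeSlab_prod (h0 : 0 < ε) (h1 : ε < 1) (G : ℝ → ℝ → ℝ) :
    ∫ x, G x.1 x.2 ∂(spikeSlab ε τ).prod (spikeSlab ε τ) =
      ∑ b : Bool, ∑ b' : Bool,
        spikeWeight ε b * spikeWeight ε b' * G (spikeVal τ b) (spikeVal τ b') := by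
  have hp : (spikeSlab ε τ).prod (spikeSlab ε τ) = ∑ b : Bool × Bool,
      (ENNReal.ofReal (spikeWeight ε b.1) * ENNReal.ofReal (spikeWeight ε b.2)) •
        Measure.dirac (spikeVal τ b.1, spikeVal τ b.2) := by
    rw [Fintype.sum_prod_type]
    simp only [spikeSlab_eq_sum, Fintype.sum_bool, Measure.add_prod, Measure.prod_add,
      Measure.prod_smul_left, Measure.prod_smul_right, Measure.dirac_prod_dirac, smul_add, smul_smul]
    rw [add_add_add_comm]
    simp only [mul_comm, add_assoc, add_comm]
  have hi : ∀ b : Bool × Bool, Integrable (fun x : ℝ × ℝ => G x.1 x.2)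
      ((ENNReal.ofReal (spikeWeight ε b.1) * ENNReal.ofReal (spikeWeight ε b.2)) •
        Measure.dirac (spikeVal τ b.1, spikeVal τ b.2)) :=
    fun b => (integrable_dirac (by simp)).smul_measure
      (ENNReal.mul_ne_top ENNReal.ofReal_ne_top ENNReal.ofReal_ne_top)
  rw [hp, integral_finsetSum_measure fun b _ => hi b, Fintype.sum_prod_type]
  simp [integral_smul_measure, ENNReal.toReal_ofReal (spikeWeight_pos h0 h1 _).le]

/-- Two coefficients are independent of the others under the prior. -/
lemma integral_coefPrior_pair_mul {ι : Type} [Fintype ι] [DecidableEq ι] (h0 : 0 < ε) (h1 : ε < 1)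
    {j j' : ι} (hj : j ≠ j') (G : ℝ → ℝ → ℝ) (hG : Measurable fun x : ℝ × ℝ => G x.1 x.2)
    (R : (({j, j'}ᶜ : Finset ι) → ℝ) → ℝ) (hR : Measurable R) :
    ∫ β, G (β j) (β j') * R (fun i => β i) ∂coefPrior ι ε τ =
      (∑ b : Bool, ∑ b' : Bool,
        spikeWeight ε b * spikeWeight ε b' * G (spikeVal τ b) (spikeVal τ b')) *
      ∫ β, R (fun i => β i) ∂coefPrior ι ε τ := by
  have := isProbabilityMeasure_spikeSlab (τ := τ) h0 h1
  have := isProbabilityMeasure_coefPrior (τ := τ) ι h0 h1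
  have hind : iIndepFun (fun (i : ι) (β : ι → ℝ) => β i) (coefPrior ι ε τ) :=
    iIndepFun_pi (X := fun _ : ι => (id : ℝ → ℝ)) fun _ => aemeasurable_id
  have hme : ∀ i : ι, (coefPrior ι ε τ).map (fun β => β i) = spikeSlab ε τ := fun i =>
    (measurePreserving_eval (fun _ : ι => spikeSlab ε τ) i).map_eq
  have h2 := (hind.indepFun hj).map_prod_eq_prod_map_map
    (measurable_pi_apply j).aemeasurable (measurable_pi_apply j').aemeasurable
  rw [hme, hme] at h2
  have h3 := hind.indepFun_finset {j, j'} ({j, j'}ᶜ) disjoint_compl_right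
    fun i => measurable_pi_apply i
  have hjm : j ∈ ({j, j'} : Finset ι) := by simp
  have hjm' : j' ∈ ({j, j'} : Finset ι) := by simp
  have h4 : IndepFun (fun β : ι → ℝ => G (β j) (β j'))
      (fun β : ι → ℝ => R (fun i => β i)) (coefPrior ι ε τ) := by
    have hφ : Measurable fun x : (({j, j'} : Finset ι) → ℝ) => (x ⟨j, hjm⟩, x ⟨j', hjm'⟩) := by
      fun_prop
    refine h3.comp (φ := fun x : (({j, j'} : Finset ι) → ℝ) => G (x ⟨j, hjm⟩) (x ⟨j', hjm'⟩))
      (ψ := R) ?_ hR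
    exact hG.comp hφ
  have h5 : Measurable fun β : ι → ℝ => G (β j) (β j') := by
    have hφ : Measurable fun β : ι → ℝ => (β j, β j') := by fun_prop
    exact hG.comp hφ
  have h6 : Measurable fun β : ι → ℝ => R (fun i => β i) :=
    hR.comp (measurable_pi_lambda _ fun i => measurable_pi_apply _)
  have h7 := h4.integral_mul_eq_mul_integral h5.aestronglyMeasurable h6.aestronglyMeasurable
  refine h7.trans ?_
  congr 1
  rw [← integral_spikeSlab_prod h0 h1 G, ← h2, integral_map (by fun_prop)
    hG.aestronglyMeasurable]

lemma integral_coefPrior_pair {ι : Type} [Fintype ι] [DecidableEq ι] (h0 : 0 < ε) (h1 : ε < 1)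
    {j j' : ι} (hj : j ≠ j') (G : ℝ → ℝ → ℝ) (hG : Measurable fun x : ℝ × ℝ => G x.1 x.2) :
    ∫ β, G (β j) (β j') ∂coefPrior ι ε τ =
      ∑ b : Bool, ∑ b' : Bool,
        spikeWeight ε b * spikeWeight ε b' * G (spikeVal τ b) (spikeVal τ b') := by
  have := isProbabilityMeasure_coefPrior (τ := τ) ι h0 h1
  simpa using integral_coefPrior_pair_mul (τ := τ) h0 h1 hj G hG (fun _ => 1) measurable_const

end Prior

/-! ### The expected errors as sums over the coefficients -/

lemma noiseLaw_prod_map_sumElim (n : ℕ) :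
    ((noiseLaw n).prod (noiseLaw n)).map (fun e => Sum.elim e.1 e.2) =
      stdGauss (Fin n ⊕ Fin n) := by
  have h := (measurePreserving_sumPiEquivProdPi_symm
    (fun _ : Fin n ⊕ Fin n => gaussianReal 0 1)).map_eq
  refine Eq.trans ?_ h
  congr 1

section Model

variable {ι : Type} [Fintype ι] [DecidableEq ι] {n : ℕ} {ε τ : ℝ}

/-- By Fubini in `β`: given `β`, the event is a shifted Gaussian event depending only on the
coefficients of `j` and `j'`. The set `P` will be `{0}` for false positives and its complement for
false negatives. -/
lemma measureReal_modelLaw (h0 : 0 < ε) (h1 : ε < 1) {j j' : ι} (hj : j ≠ j')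
    (mean : ℝ → ℝ → Fin n ⊕ Fin n → ℝ)
    (hmean : Measurable fun x : ℝ × ℝ => mean x.1 x.2) {P : Set ℝ} (hP : MeasurableSet P)
    {S : Set (Fin n ⊕ Fin n → ℝ)} (hS : MeasurableSet S) :
    (modelLaw ι n ε τ).real {ω | ω.1 j ∈ P ∧
        mean (ω.1 j) (ω.1 j') + Sum.elim ω.2.1 ω.2.2 ∈ S} =
      ∑ b : Bool, ∑ b' : Bool, spikeWeight ε b * spikeWeight ε b' *
        (P.indicator 1 (spikeVal τ b) * (stdGauss (Fin n ⊕ Fin n)).real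
          {e | mean (spikeVal τ b) (spikeVal τ b') + e ∈ S}) := by
  have hp1 : IsProbabilityMeasure (noiseLaw n) := by unfold noiseLaw; infer_instance
  have hp2 := isProbabilityMeasure_coefPrior (τ := τ) ι h0 h1
  have hel : Measurable fun e : (Fin n → ℝ) × (Fin n → ℝ) => (Sum.elim e.1 e.2 : Fin n ⊕ Fin n → ℝ) := by
    refine measurable_pi_lambda _ fun i => ?_
    cases i
    · exact (measurable_pi_apply _).comp measurable_fst
    · exact (measurable_pi_apply _).comp measurable_snd
  have hA : MeasurableSet {ω : (ι → ℝ) × (Fin n → ℝ) × (Fin n → ℝ) | ω.1 j ∈ P ∧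
      mean (ω.1 j) (ω.1 j') + Sum.elim ω.2.1 ω.2.2 ∈ S} := by
    have m1 : Measurable fun ω : (ι → ℝ) × (Fin n → ℝ) × (Fin n → ℝ) => ω.1 j :=
      (measurable_pi_apply _).comp measurable_fst
    have m2 : Measurable fun ω : (ι → ℝ) × (Fin n → ℝ) × (Fin n → ℝ) => ω.1 j' :=
      (measurable_pi_apply _).comp measurable_fst
    exact (m1 hP).inter (((hmean.comp (m1.prodMk m2)).add (hel.comp measurable_snd)) hS)
  have hG : Measurable fun x : ℝ × ℝ => P.indicator (1 : ℝ → ℝ) x.1 *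
      (stdGauss (Fin n ⊕ Fin n)).real {e | mean x.1 x.2 + e ∈ S} := by
    refine ((measurable_one.indicator hP).comp measurable_fst).mul ?_
    refine (measurable_measure_prodMk_left (ν := stdGauss (Fin n ⊕ Fin n))
      (s := {y : (ℝ × ℝ) × (Fin n ⊕ Fin n → ℝ) | mean y.1.1 y.1.2 + y.2 ∈ S}) ?_).ennreal_toReal
    exact ((hmean.comp measurable_fst).add measurable_snd) hS
  rw [← integral_coefPrior_pair (τ := τ) h0 h1 hj (fun u u' => P.indicator 1 u *
    (stdGauss (Fin n ⊕ Fin n)).real {e | mean u u' + e ∈ S}) hG]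
  rw [measureReal_def, modelLaw, Measure.prod_apply hA, ← integral_toReal
    (measurable_measure_prodMk_left hA).aemeasurable
    (Eventually.of_forall fun _ => measure_lt_top _ _)]
  refine integral_congr_ae (Eventually.of_forall fun β => ?_)
  simp only
  have hadd : Measurable fun e => mean (β j) (β j') + e := measurable_const_add _
  have hmap : (stdGauss (Fin n ⊕ Fin n)) {e | mean (β j) (β j') + e ∈ S} =
      ((noiseLaw n).prod (noiseLaw n))
        {e | mean (β j) (β j') + Sum.elim e.1 e.2 ∈ S} := by
    rw [← noiseLaw_prod_map_sumElim n]
    exact Measure.map_apply hel (hadd hS)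
  rw [measureReal_def, hmap]
  by_cases hβ : β j ∈ P
  · rw [Set.indicator_of_mem hβ, Pi.one_apply, one_mul]
    congr 2
    ext e
    exact ⟨fun h => h.2, fun h => ⟨hβ, h⟩⟩
  · rw [Set.indicator_of_notMem hβ, zero_mul]
    have : (Prod.mk β ⁻¹' {ω : (ι → ℝ) × (Fin n → ℝ) × (Fin n → ℝ) | ω.1 j ∈ P ∧
      mean (ω.1 j) (ω.1 j') + Sum.elim ω.2.1 ω.2.2 ∈ S}) = ∅ :=
      Set.eq_empty_of_forall_notMem fun e he => hβ he.1
    rw [this, measure_empty, ENNReal.toReal_zero]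

lemma integral_ncard_modelLaw {ι : Type} [Fintype ι] {n : ℕ} {ε τ : ℝ} (h0 : 0 < ε) (h1 : ε < 1)
    (A : (ι → ℝ) × (Fin n → ℝ) × (Fin n → ℝ) → Set ι) (hA : ∀ j, MeasurableSet {ω | j ∈ A ω}) :
    ∫ ω, ((A ω).ncard : ℝ) ∂modelLaw ι n ε τ = ∑ j, (modelLaw ι n ε τ).real {ω | j ∈ A ω} := by
  have hp1 : IsProbabilityMeasure (noiseLaw n) := by unfold noiseLaw; infer_instance
  have hp2 := isProbabilityMeasure_coefPrior (τ := τ) ι h0 h1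
  have hp3 : IsProbabilityMeasure (modelLaw ι n ε τ) := by unfold modelLaw; infer_instance
  have h : ∀ ω, ((A ω).ncard : ℝ) = ∑ j, {ω | j ∈ A ω}.indicator (fun _ => (1 : ℝ)) ω := by
    intro ω
    classical
    rw [Set.ncard_eq_toFinset_card', Finset.card_eq_sum_ones, Nat.cast_sum]
    simp only [Set.indicator_apply, Nat.cast_one]
    rw [← Finset.sum_filter]
    refine Finset.sum_congr ?_ fun _ _ => rfl
    ext j
    simp
  simp_rw [h]
  rw [integral_finsetSum _ fun j _ => (integrable_const (1 : ℝ)).indicator (hA j)]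
  exact Finset.sum_congr rfl fun j _ => integral_indicator_one (hA j)

variable {X₁ X₂ : Matrix (Fin n) ι ℝ} {W : (Fin n → ℝ) → (Fin n → ℝ) → ι → ℝ}

/-- The errors of a statistic whose `j`-th coordinate is a function of a Gaussian shift experiment
indexed by the `j`-th coefficient and its partner. -/
lemma falsePos_falseNeg_eq_sum (h0 : 0 < ε) (h1 : ε < 1) (hτ : τ ≠ 0) (partner : ι → ι)
    (hpartner : ∀ j, j ≠ partner j) (mean : ι → ℝ → ℝ → Fin n ⊕ Fin n → ℝ)
    (hmean : ∀ j, Measurable fun x : ℝ × ℝ => mean j x.1 x.2)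
    (F : ι → (Fin n ⊕ Fin n → ℝ) → ℝ) (hF : ∀ j, Measurable (F j))
    (hW : ∀ β e₁ e₂ j, W (response X₁ β e₁) (response X₂ β e₂) j =
      F j (mean j (β j) (β (partner j)) + Sum.elim e₁ e₂)) (t : ℝ) :
    falsePos ε τ X₁ X₂ W t = ∑ j, ∫ z in {z | t ≤ F j z},
      margDens ε (fun b b' => mean j (spikeVal τ b) (spikeVal τ b')) false z
        ∂stdGauss (Fin n ⊕ Fin n) ∧
    falseNeg ε τ X₁ X₂ W t = ∑ j, ∫ z in {z | t ≤ F j z}ᶜ,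
      margDens ε (fun b b' => mean j (spikeVal τ b) (spikeVal τ b')) true z
        ∂stdGauss (Fin n ⊕ Fin n) := by
  have hS : ∀ j, MeasurableSet {z | t ≤ F j z} := fun j => measurableSet_le measurable_const (hF j)
  have e1 : ∀ j, {ω : (ι → ℝ) × (Fin n → ℝ) × (Fin n → ℝ) |
      j ∈ selected (W (response X₁ ω.1 ω.2.1) (response X₂ ω.1 ω.2.2)) t \ relevant ω.1} =
      {ω | ω.1 j ∈ ({0} : Set ℝ) ∧
        mean j (ω.1 j) (ω.1 (partner j)) + Sum.elim ω.2.1 ω.2.2 ∈ {z | t ≤ F j z}} := by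
    intro j
    ext ω
    change (t ≤ W _ _ j ∧ ¬ (ω.1 j ≠ 0)) ↔ (ω.1 j = 0 ∧ t ≤ F j _)
    rw [hW, not_not, and_comm]
  have e2 : ∀ j, {ω : (ι → ℝ) × (Fin n → ℝ) × (Fin n → ℝ) |
      j ∈ relevant ω.1 \ selected (W (response X₁ ω.1 ω.2.1) (response X₂ ω.1 ω.2.2)) t} =
      {ω | ω.1 j ∈ ({0}ᶜ : Set ℝ) ∧
        mean j (ω.1 j) (ω.1 (partner j)) + Sum.elim ω.2.1 ω.2.2 ∈ {z | t ≤ F j z}ᶜ} := by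
    intro j
    ext ω
    change (ω.1 j ≠ 0 ∧ ¬ (t ≤ W _ _ j)) ↔ (ω.1 j ≠ 0 ∧ ¬ (t ≤ F j _))
    rw [hW]
  have hel : Measurable fun e : (Fin n → ℝ) × (Fin n → ℝ) => (Sum.elim e.1 e.2 : Fin n ⊕ Fin n → ℝ) := by
    refine measurable_pi_lambda _ fun i => ?_
    cases i
    · exact (measurable_pi_apply _).comp measurable_fst
    · exact (measurable_pi_apply _).comp measurable_snd
  have hmeas : ∀ (j : ι) (P : Set ℝ) (S : Set (Fin n ⊕ Fin n → ℝ)), MeasurableSet P →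
      MeasurableSet S → MeasurableSet {ω : (ι → ℝ) × (Fin n → ℝ) × (Fin n → ℝ) | ω.1 j ∈ P ∧
        mean j (ω.1 j) (ω.1 (partner j)) + Sum.elim ω.2.1 ω.2.2 ∈ S} := by
    intro j P S hP hS
    have m1 : ∀ i, Measurable fun ω : (ι → ℝ) × (Fin n → ℝ) × (Fin n → ℝ) => ω.1 i :=
      fun i => (measurable_pi_apply _).comp measurable_fst
    exact (m1 j hP).inter ((((hmean j).comp ((m1 j).prodMk (m1 _))).add
      (hel.comp measurable_snd)) hS)
  have h0s : MeasurableSet ({0} : Set ℝ) := measurableSet_singleton 0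
  constructor
  · rw [falsePos, integral_ncard_modelLaw h0 h1 _ fun j => by
      rw [e1]; exact hmeas j _ _ h0s (hS j)]
    refine Finset.sum_congr rfl fun j _ => ?_
    rw [e1, measureReal_modelLaw h0 h1 (hpartner j) (mean j) (hmean j) h0s (hS j),
      setIntegral_margDens _ (hS j)]
    -- Since `τ ≠ 0`, the coefficient vanishes exactly in the state `false`.
    simp [spikeVal, hτ]
  · rw [falseNeg, integral_ncard_modelLaw h0 h1 _ fun j => by
      rw [e2]; exact hmeas j _ _ h0s.compl (hS j).compl]
    refine Finset.sum_congr rfl fun j _ => ?_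
    rw [e2, measureReal_modelLaw h0 h1 (hpartner j) (mean j) (hmean j) h0s.compl (hS j).compl,
      setIntegral_margDens _ (hS j).compl]
    simp [spikeVal, hτ]

end Model

/-! ### The block design -/

/-- The other feature of the block of `j`. -/
def partner {m : ℕ} (j : Fin 2 × Fin m) : Fin 2 × Fin m := (1 - j.1, j.2)

lemma partner_partner {m : ℕ} (j : Fin 2 × Fin m) : partner (partner j) = j := by
  simp [partner]

lemma ne_partner {m : ℕ} (j : Fin 2 × Fin m) : j ≠ partner j := by
  obtain ⟨i, k⟩ := j
  fin_cases i <;> simp [partner]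

lemma blockGram_mulVec (ρ : ℝ) (m : ℕ) (β : Fin 2 × Fin m → ℝ) (j : Fin 2 × Fin m) :
    (blockGram ρ m *ᵥ β) j = 1 / 2 * (β j + ρ * β (partner j)) := by
  obtain ⟨i, k⟩ := j
  rw [blockGram, Matrix.smul_mulVec, Pi.smul_apply, smul_eq_mul, Matrix.mulVec, dotProduct,
    Fintype.sum_prod_type]
  simp only [Matrix.blockDiagonal_apply, ite_mul, zero_mul, Finset.sum_ite_eq, Finset.mem_univ,
    if_true, Fin.sum_univ_two]
  fin_cases i <;> simp [partner, add_comm]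

/-- The inverse of the Gram matrix. -/
def blockGramInv (ρ : ℝ) (m : ℕ) : Matrix (Fin 2 × Fin m) (Fin 2 × Fin m) ℝ :=
  (2 / (1 - ρ ^ 2)) • Matrix.blockDiagonal fun _ : Fin m => !![1, -ρ; -ρ, 1]

lemma one_sub_sq_pos {ρ : ℝ} (hρ : |ρ| < 1) : 0 < 1 - ρ ^ 2 := by
  have := (sq_lt_one_iff_abs_lt_one ρ).2 hρ
  linarith

lemma blockGram_mul_inv {ρ : ℝ} (hρ : |ρ| < 1) (m : ℕ) :
    blockGram ρ m * blockGramInv ρ m = 1 := by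
  have hw := (one_sub_sq_pos hρ).ne'
  rw [blockGram, blockGramInv, Matrix.smul_mul, Matrix.mul_smul, ← Matrix.blockDiagonal_mul,
    smul_smul]
  have h : (fun _ : Fin m => !![1, ρ; ρ, 1] * !![1, -ρ; -ρ, 1]) =
      (1 - ρ ^ 2) • (1 : Fin m → Matrix (Fin 2) (Fin 2) ℝ) := by
    ext k a b
    fin_cases a <;> fin_cases b <;> simp [Matrix.mul_apply] <;> ring
  rw [h, Matrix.blockDiagonal_smul, Matrix.blockDiagonal_one, smul_smul]
  rw [show 1 / 2 * (2 / (1 - ρ ^ 2)) * (1 - ρ ^ 2) = 1 by field_simp, one_smul]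

/-- The row of `(XᵀX)⁻¹ Xᵀ` that computes the `j`-th least-squares coefficient. -/
def olsRow {ι : Type} [Fintype ι] [DecidableEq ι] {n : ℕ} (X : Matrix (Fin n) ι ℝ) (j : ι) :
    Fin n → ℝ :=
  ((Xᵀ * X)⁻¹ * Xᵀ) j

lemma ols_eq_olsRow {ι : Type} [Fintype ι] [DecidableEq ι] {n : ℕ} (X : Matrix (Fin n) ι ℝ)
    (y : Fin n → ℝ) (j : ι) : ols X y j = olsRow X j ⬝ᵥ y := by
  rw [ols, Matrix.mulVec_mulVec]
  rfl

section Design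

variable {n m : ℕ} {ρ : ℝ} {X : Matrix (Fin n) (Fin 2 × Fin m) ℝ}

lemma gram_inv (hρ : |ρ| < 1) (hX : Xᵀ * X = blockGram ρ m) :
    (Xᵀ * X)⁻¹ = blockGramInv ρ m := by
  rw [hX]
  exact Matrix.inv_eq_right_inv (blockGram_mul_inv hρ m)

lemma inv_gram_mul_gram (hρ : |ρ| < 1) (hX : Xᵀ * X = blockGram ρ m) :
    (Xᵀ * X)⁻¹ * (Xᵀ * X) = 1 := by
  rw [gram_inv hρ hX, hX]
  exact mul_eq_one_comm.1 (blockGram_mul_inv hρ m)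

lemma olsVar_eq (hρ : |ρ| < 1) (hX : Xᵀ * X = blockGram ρ m) (j : Fin 2 × Fin m) :
    ((olsVar X j : ℝ≥0) : ℝ) = 2 / (1 - ρ ^ 2) := by
  have hw := one_sub_sq_pos hρ
  have h : (Xᵀ * X)⁻¹ j j = 2 / (1 - ρ ^ 2) := by
    obtain ⟨i, k⟩ := j
    rw [gram_inv hρ hX, blockGramInv, Matrix.smul_apply, Matrix.blockDiagonal_apply]
    fin_cases i <;> simp
  rw [olsVar, h, Real.coe_toNNReal _ (by positivity)]

lemma olsRow_dotProduct_mulVec (hρ : |ρ| < 1) (hX : Xᵀ * X = blockGram ρ m) (j : Fin 2 × Fin m)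
    (β : Fin 2 × Fin m → ℝ) : olsRow X j ⬝ᵥ (X *ᵥ β) = β j := by
  change (((Xᵀ * X)⁻¹ * Xᵀ) *ᵥ (X *ᵥ β)) j = β j
  rw [Matrix.mulVec_mulVec, Matrix.mul_assoc, inv_gram_mul_gram hρ hX, Matrix.one_mulVec]

lemma olsRow_dotProduct_self (hρ : |ρ| < 1) (hX : Xᵀ * X = blockGram ρ m) (j : Fin 2 × Fin m) :
    olsRow X j ⬝ᵥ olsRow X j = 2 / (1 - ρ ^ 2) := by
  have hw := one_sub_sq_pos hρ
  have h : olsRow X j ⬝ᵥ olsRow X j =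
      (((Xᵀ * X)⁻¹ * Xᵀ) * ((Xᵀ * X)⁻¹ * Xᵀ)ᵀ) j j := rfl
  rw [h, Matrix.transpose_mul, Matrix.transpose_transpose, Matrix.mul_assoc,
    ← Matrix.mul_assoc Xᵀ X, Matrix.transpose_nonsing_inv, Matrix.transpose_mul,
    Matrix.transpose_transpose, ← Matrix.mul_assoc, inv_gram_mul_gram hρ hX, Matrix.one_mul,
    ← olsVar_eq hρ hX j, olsVar, Real.coe_toNNReal']
  symm
  apply max_eq_left
  obtain ⟨i, k⟩ := j
  rw [gram_inv hρ hX, blockGramInv, Matrix.smul_apply, Matrix.blockDiagonal_apply]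
  fin_cases i <;> simp <;> positivity

lemma col_dotProduct_mulVec (hX : Xᵀ * X = blockGram ρ m) (j : Fin 2 × Fin m)
    (β : Fin 2 × Fin m → ℝ) :
    Xᵀ j ⬝ᵥ (X *ᵥ β) = 1 / 2 * (β j + ρ * β (partner j)) := by
  rw [← blockGram_mulVec, ← hX, ← Matrix.mulVec_mulVec]
  rfl

lemma col_dotProduct_col (hX : Xᵀ * X = blockGram ρ m) (j i : Fin 2 × Fin m) :
    Xᵀ j ⬝ᵥ Xᵀ i = 1 / 2 * ((if j = i then 1 else 0) + ρ * if partner j = i then 1 else 0) := by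
  have h : Xᵀ i = X *ᵥ Pi.single i 1 := by
    rw [Matrix.mulVec_single_one]; rfl
  rw [h, col_dotProduct_mulVec hX, Pi.single_apply, Pi.single_apply]

end Design

/-! ### The shift experiments behind the mirror statistics -/

/-- The mean of the data on which the Bayes-optimal mirror statistic of the `j`-th feature depends,
when the coefficients of `j` and of its partner are `u` and `u'`. -/
def starMean {n m : ℕ} (ρ : ℝ) (X₁ X₂ : Matrix (Fin n) (Fin 2 × Fin m) ℝ) (j : Fin 2 × Fin m)
    (u u' : ℝ) : Fin n ⊕ Fin n → ℝ :=
  Sum.elim (u • X₁ᵀ j + u' • X₁ᵀ (partner j)) ((u * ((1 - ρ ^ 2) / 2)) • olsRow X₂ j)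

/-- The mean of the pair of the `j`-th least-squares coefficients, as a vector of the data space,
when the coefficient of `j` is `u`. -/
def tildeMean {n m : ℕ} (ρ : ℝ) (X₁ X₂ : Matrix (Fin n) (Fin 2 × Fin m) ℝ) (j : Fin 2 × Fin m)
    (u : ℝ) : Fin n ⊕ Fin n → ℝ :=
  Sum.elim ((u * ((1 - ρ ^ 2) / 2)) • olsRow X₁ j) ((u * ((1 - ρ ^ 2) / 2)) • olsRow X₂ j)

/-- The direction of the `j`-th least-squares coefficient of the second half. -/
def secondDir {n m : ℕ} (ρ τ : ℝ) (X₂ : Matrix (Fin n) (Fin 2 × Fin m) ℝ) (j : Fin 2 × Fin m) :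
    Fin n ⊕ Fin n → ℝ :=
  Sum.elim 0 ((τ * ((1 - ρ ^ 2) / 2)) • olsRow X₂ j)

section Means

variable {n m : ℕ} {ρ : ℝ} {X₁ X₂ : Matrix (Fin n) (Fin 2 × Fin m) ℝ}

lemma starMean_dotProduct_elim (j : Fin 2 × Fin m) (u u' : ℝ) (y₁ y₂ : Fin n → ℝ) :
    starMean ρ X₁ X₂ j u u' ⬝ᵥ Sum.elim y₁ y₂ = u * (X₁ᵀ j ⬝ᵥ y₁) + u' * (X₁ᵀ (partner j) ⬝ᵥ y₁) +
      u * ((1 - ρ ^ 2) / 2) * (olsRow X₂ j ⬝ᵥ y₂) := by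
  simp [starMean, add_dotProduct, smul_dotProduct]

lemma tildeMean_dotProduct_elim (j : Fin 2 × Fin m) (u : ℝ) (y₁ y₂ : Fin n → ℝ) :
    tildeMean ρ X₁ X₂ j u ⬝ᵥ Sum.elim y₁ y₂ =
      u * ((1 - ρ ^ 2) / 2) * (olsRow X₁ j ⬝ᵥ y₁ + olsRow X₂ j ⬝ᵥ y₂) := by
  simp [tildeMean, smul_dotProduct]
  ring

lemma secondDir_dotProduct_elim (τ : ℝ) (j : Fin 2 × Fin m) (y₁ y₂ : Fin n → ℝ) :
    secondDir ρ τ X₂ j ⬝ᵥ Sum.elim y₁ y₂ = τ * ((1 - ρ ^ 2) / 2) * (olsRow X₂ j ⬝ᵥ y₂) := by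
  simp [secondDir, smul_dotProduct]

lemma starMean_dotProduct_starMean (hρ : |ρ| < 1) (hX₁ : X₁ᵀ * X₁ = blockGram ρ m)
    (hX₂ : X₂ᵀ * X₂ = blockGram ρ m) (j : Fin 2 × Fin m) (u u' s s' : ℝ) :
    starMean ρ X₁ X₂ j u u' ⬝ᵥ starMean ρ X₁ X₂ j s s' =
      1 / 2 * (u * s + ρ * u * s' + ρ * u' * s + u' * s') + u * s * ((1 - ρ ^ 2) / 2) := by
  have hw := (one_sub_sq_pos hρ).ne'
  conv_lhs => rw [starMean.eq_1 ρ X₁ X₂ j s s', starMean_dotProduct_elim]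
  simp only [dotProduct_add, dotProduct_smul, col_dotProduct_col hX₁,
    olsRow_dotProduct_self hρ hX₂, smul_eq_mul, partner_partner, ne_partner j, (ne_partner j).symm,
    if_true, if_false]
  field_simp
  ring

lemma tildeMean_dotProduct_tildeMean (hρ : |ρ| < 1) (hX₁ : X₁ᵀ * X₁ = blockGram ρ m)
    (hX₂ : X₂ᵀ * X₂ = blockGram ρ m) (j : Fin 2 × Fin m) (u s : ℝ) :
    tildeMean ρ X₁ X₂ j u ⬝ᵥ tildeMean ρ X₁ X₂ j s = u * s * (1 - ρ ^ 2) := by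
  have hw := (one_sub_sq_pos hρ).ne'
  conv_lhs => rw [tildeMean.eq_1 ρ X₁ X₂ j s, tildeMean_dotProduct_elim]
  simp only [dotProduct_smul, olsRow_dotProduct_self hρ hX₁,
    olsRow_dotProduct_self hρ hX₂, smul_eq_mul]
  field_simp
  ring

lemma secondDir_dotProduct_starMean (hρ : |ρ| < 1) (hX₂ : X₂ᵀ * X₂ = blockGram ρ m)
    (τ : ℝ) (j : Fin 2 × Fin m) (u u' : ℝ) :
    secondDir ρ τ X₂ j ⬝ᵥ starMean ρ X₁ X₂ j u u' = τ * u * ((1 - ρ ^ 2) / 2) := by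
  have hw := (one_sub_sq_pos hρ).ne'
  rw [starMean, secondDir_dotProduct_elim, dotProduct_smul, olsRow_dotProduct_self hρ hX₂,
    smul_eq_mul]
  field_simp

lemma secondDir_dotProduct_tildeMean (hρ : |ρ| < 1) (hX₂ : X₂ᵀ * X₂ = blockGram ρ m)
    (τ : ℝ) (j : Fin 2 × Fin m) (u : ℝ) :
    secondDir ρ τ X₂ j ⬝ᵥ tildeMean ρ X₁ X₂ j u = τ * u * ((1 - ρ ^ 2) / 2) := by
  have hw := (one_sub_sq_pos hρ).ne'
  rw [tildeMean, secondDir_dotProduct_elim, dotProduct_smul, olsRow_dotProduct_self hρ hX₂,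
    smul_eq_mul]
  field_simp

lemma secondDir_dotProduct_self (hρ : |ρ| < 1) (hX₂ : X₂ᵀ * X₂ = blockGram ρ m)
    (τ : ℝ) (j : Fin 2 × Fin m) :
    secondDir ρ τ X₂ j ⬝ᵥ secondDir ρ τ X₂ j = τ * τ * ((1 - ρ ^ 2) / 2) := by
  have hw := (one_sub_sq_pos hρ).ne'
  refine (secondDir_dotProduct_elim τ j 0 _).trans ?_
  rw [dotProduct_smul, olsRow_dotProduct_self hρ hX₂, smul_eq_mul]
  field_simp

lemma measurable_starMean (j : Fin 2 × Fin m) :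
    Measurable fun x : ℝ × ℝ => starMean ρ X₁ X₂ j x.1 x.2 := by
  refine measurable_pi_lambda _ fun i => ?_
  cases i <;> simp only [starMean, Sum.elim_inl, Sum.elim_inr, Pi.add_apply, Pi.smul_apply,
    smul_eq_mul] <;> fun_prop

lemma measurable_tildeMean (j : Fin 2 × Fin m) :
    Measurable fun x : ℝ × ℝ => tildeMean ρ X₁ X₂ j x.1 := by
  refine measurable_pi_lambda _ fun i => ?_
  cases i <;> simp only [tildeMean, Sum.elim_inl, Sum.elim_inr, Pi.smul_apply,
    smul_eq_mul] <;> fun_prop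

/-- The response has another mean, since all blocks contribute, but the inner products agree with
the noise unchanged: other blocks are orthogonal to the block of `j`, and the factor `(1 - ρ ^ 2) /
2`, an inverse variance, makes the second-half estimate have mean `βⱼ`. -/
lemma starMean_dotProduct_response (hρ : |ρ| < 1) (hX₁ : X₁ᵀ * X₁ = blockGram ρ m)
    (hX₂ : X₂ᵀ * X₂ = blockGram ρ m) (j : Fin 2 × Fin m) (u u' : ℝ) (β : Fin 2 × Fin m → ℝ)
    (e₁ e₂ : Fin n → ℝ) :
    starMean ρ X₁ X₂ j u u' ⬝ᵥ Sum.elim (response X₁ β e₁) (response X₂ β e₂) =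
      starMean ρ X₁ X₂ j u u' ⬝ᵥ
        (starMean ρ X₁ X₂ j (β j) (β (partner j)) + Sum.elim e₁ e₂) := by
  rw [dotProduct_add, starMean_dotProduct_starMean hρ hX₁ hX₂, starMean_dotProduct_elim,
    starMean_dotProduct_elim]
  simp only [response, dotProduct_add, col_dotProduct_mulVec hX₁,
    olsRow_dotProduct_mulVec hρ hX₂, partner_partner]
  ring

lemma secondDir_dotProduct_response (hρ : |ρ| < 1)
    (hX₂ : X₂ᵀ * X₂ = blockGram ρ m) (τ : ℝ) (j : Fin 2 × Fin m) (β : Fin 2 × Fin m → ℝ)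
    (e₁ e₂ : Fin n → ℝ) :
    secondDir ρ τ X₂ j ⬝ᵥ Sum.elim (response X₁ β e₁) (response X₂ β e₂) =
      secondDir ρ τ X₂ j ⬝ᵥ
        (starMean ρ X₁ X₂ j (β j) (β (partner j)) + Sum.elim e₁ e₂) := by
  rw [dotProduct_add, secondDir_dotProduct_starMean hρ hX₂, secondDir_dotProduct_elim,
    secondDir_dotProduct_elim]
  simp only [response, dotProduct_add, olsRow_dotProduct_mulVec hρ hX₂]
  ring

/-- The least-squares coefficients as functionals of the data of the shift experiment. -/
lemma olsRow_response_eq (hρ : |ρ| < 1) (hX₁ : X₁ᵀ * X₁ = blockGram ρ m)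
    (hX₂ : X₂ᵀ * X₂ = blockGram ρ m) (j : Fin 2 × Fin m) (β : Fin 2 × Fin m → ℝ)
    (e₁ e₂ : Fin n → ℝ) :
    ols X₁ (response X₁ β e₁) j =
        Sum.elim (olsRow X₁ j) 0 ⬝ᵥ (tildeMean ρ X₁ X₂ j (β j) + Sum.elim e₁ e₂) ∧
      ols X₂ (response X₂ β e₂) j =
        Sum.elim 0 (olsRow X₂ j) ⬝ᵥ (tildeMean ρ X₁ X₂ j (β j) + Sum.elim e₁ e₂) := by
  have hw := (one_sub_sq_pos hρ).ne'
  constructor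
  all_goals
    simp only [ols_eq_olsRow, response, dotProduct_add, olsRow_dotProduct_mulVec hρ hX₁,
      olsRow_dotProduct_mulVec hρ hX₂, tildeMean, sumElim_dotProduct_sumElim,
      zero_dotProduct, dotProduct_smul, olsRow_dotProduct_self hρ hX₁,
      olsRow_dotProduct_self hρ hX₂, smul_eq_mul]
    field_simp
    ring

end Means

/-! ### Explicit forms of the posterior mirror statistics -/

lemma integral_posterior {Θ : Type} [MeasurableSpace Θ] (π : Measure Θ) {L : Θ → ℝ≥0∞}
    (hL : Measurable L) (hL' : ∀ θ, L θ ≠ ∞) (F : Θ → ℝ) :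
    ∫ θ, F θ ∂posterior π L = ((∫⁻ θ, L θ ∂π)⁻¹).toReal * ∫ θ, (L θ).toReal * F θ ∂π := by
  rw [posterior, integral_smul_measure, integral_withDensity_eq_integral_toReal_smul hL
    (Eventually.of_forall fun θ => (hL' θ).lt_top)]
  rfl

/-- The factored null density is even in `t`, so it cancels in the mirror ratio. -/
lemma gaussianPDFReal_eq_mul_exp (u : ℝ) (v : ℝ≥0) (t : ℝ) :
    gaussianPDFReal u v t = gaussianPDFReal 0 v t * Real.exp (u * t / v - u * u / (2 * v)) := by
  simp only [gaussianPDFReal, mul_assoc, ← Real.exp_add]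
  congr 2
  by_cases hv : (v : ℝ) = 0
  · simp [hv]
  · field_simp
    ring

lemma gaussianPDFReal_zero_neg (v : ℝ≥0) (t : ℝ) :
    gaussianPDFReal 0 v (-t) = gaussianPDFReal 0 v t := by
  simp [gaussianPDFReal]

lemma likelihood_toReal {ι : Type} [Fintype ι] {n : ℕ} (X : Matrix (Fin n) ι ℝ) (y : Fin n → ℝ)
    (β : ι → ℝ) :
    (likelihood X y β).toReal = (∏ i, gaussianPDFReal 0 1 (y i)) * cmDens (X *ᵥ β) y := by
  rw [likelihood, ENNReal.toReal_prod, cmDens, dotProduct, dotProduct, Finset.sum_div,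
    ← Finset.sum_sub_distrib, Real.exp_sum, ← Finset.prod_mul_distrib]
  refine Finset.prod_congr rfl fun i _ => ?_
  rw [toReal_gaussianPDF, gaussianPDFReal_eq_mul_exp]
  simp

lemma likelihood_ne {ι : Type} [Fintype ι] {n : ℕ} (X : Matrix (Fin n) ι ℝ) (y : Fin n → ℝ)
    (β : ι → ℝ) : likelihood X y β ≠ 0 ∧ likelihood X y β ≠ ∞ :=
  ⟨Finset.prod_ne_zero_iff.2 fun _ _ => (gaussianPDF_pos _ one_ne_zero _).ne',
    ENNReal.prod_ne_top fun _ _ => gaussianPDF_ne_top⟩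

lemma measurable_likelihood {ι : Type} [Fintype ι] {n : ℕ} (X : Matrix (Fin n) ι ℝ)
    (y : Fin n → ℝ) : Measurable (likelihood X y) := by
  refine Finset.measurable_prod _ fun i _ => ?_
  refine measurable_uncurry_gaussianPDF.comp
    (f := fun β : ι → ℝ => ((X *ᵥ β) i, (1 : ℝ≥0), y i)) ?_
  exact (measurable_dotProduct (X i)).prodMk (measurable_const.prodMk measurable_const)

/-- The predictive densities at `t` and `-t` in a mixture over a coefficient in `{0, τ}`. -/
lemma log_predictive_ratio {C A₀ A₁ s φ : ℝ} (hC : C ≠ 0) (hφ : φ ≠ 0) :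
    Real.log ((C * (φ * (A₀ + A₁ * Real.exp s))) / (C * (φ * (A₀ + A₁ * Real.exp (-s))))) =
      Real.log ((A₀ + A₁ * Real.exp s) / (A₀ + A₁ * Real.exp s * Real.exp (-(2 * s)))) := by
  rw [mul_div_mul_left _ _ hC, mul_div_mul_left _ _ hφ, mul_assoc A₁, ← Real.exp_add]
  ring_nf

section

variable {n m : ℕ} {ρ ε τ : ℝ} {X₁ X₂ : Matrix (Fin n) (Fin 2 × Fin m) ℝ}

/-- The log-likelihood of the block of `j`, up to a constant. -/
def blockLogLik (ρ : ℝ) (c c' u u' : ℝ) : ℝ :=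
  u * c + u' * c' - 1 / 4 * (u * u + 2 * ρ * u * u' + u' * u')

/-- The Gram matrix is block diagonal, so the likelihood splits into a factor for the block of `j`
and a factor for the other blocks. -/
lemma cmDens_mulVec (hX₁ : X₁ᵀ * X₁ = blockGram ρ m) (y : Fin n → ℝ) (j : Fin 2 × Fin m)
    (β : Fin 2 × Fin m → ℝ) :
    cmDens (X₁ *ᵥ β) y =
      Real.exp (blockLogLik ρ (X₁ᵀ j ⬝ᵥ y) (X₁ᵀ (partner j) ⬝ᵥ y) (β j) (β (partner j))) *
      Real.exp (∑ i ∈ {j, partner j}ᶜ, (β i * (X₁ᵀ i ⬝ᵥ y) -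
        1 / 4 * (β i * (β i + ρ * β (partner i))))) := by
  rw [cmDens, ← Real.exp_add]
  congr 1
  have h1 : (X₁ *ᵥ β) ⬝ᵥ y = ∑ i, β i * (X₁ᵀ i ⬝ᵥ y) := by
    rw [dotProduct_comm, Matrix.dotProduct_mulVec, dotProduct_comm]
    refine Finset.sum_congr rfl fun i _ => ?_
    rw [Matrix.vecMul, dotProduct_comm]
    rfl
  have h2 : (X₁ *ᵥ β) ⬝ᵥ (X₁ *ᵥ β) = ∑ i, β i * (1 / 2 * (β i + ρ * β (partner i))) := by
    rw [Matrix.dotProduct_mulVec, dotProduct_comm]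
    refine Finset.sum_congr rfl fun i _ => ?_
    rw [← col_dotProduct_mulVec hX₁, dotProduct_comm (X₁ᵀ i)]
    rfl
  have h3 : (X₁ *ᵥ β) ⬝ᵥ y - (X₁ *ᵥ β) ⬝ᵥ (X₁ *ᵥ β) / 2 =
      ∑ i, (β i * (X₁ᵀ i ⬝ᵥ y) - 1 / 4 * (β i * (β i + ρ * β (partner i)))) := by
    rw [h1, h2, Finset.sum_sub_distrib, Finset.sum_div]
    congr 1
    exact Finset.sum_congr rfl fun i _ => by ring
  rw [h3, ← Finset.sum_add_sum_compl {j, partner j}, Finset.sum_pair (ne_partner j),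
    partner_partner, blockLogLik]
  ring

/-- The evidence, the null density of `y` and the integral over the other blocks do not depend on
`t`. They are collected in `C`, which cancels in the mirror ratio. -/
lemma exists_predictiveStar_eq (h0 : 0 < ε) (h1 : ε < 1) (hX₁ : X₁ᵀ * X₁ = blockGram ρ m)
    (y : Fin n → ℝ) (j : Fin 2 × Fin m) :
    ∃ C : ℝ, C ≠ 0 ∧ ∀ t, predictiveStar ε τ X₁ X₂ y j t =
      C * ∑ b : Bool, ∑ b' : Bool, spikeWeight ε b * spikeWeight ε b' *
        (gaussianPDFReal (spikeVal τ b) (olsVar X₂ j) t *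
          Real.exp (blockLogLik ρ (X₁ᵀ j ⬝ᵥ y) (X₁ᵀ (partner j) ⬝ᵥ y)
            (spikeVal τ b) (spikeVal τ b'))) := by
  -- The complement of a block is closed under `partner`, so the remaining likelihood factor is a
  -- function of the remaining coordinates alone.
  have hmem : ∀ i : (({j, partner j}ᶜ : Finset (Fin 2 × Fin m))),
      partner (i : Fin 2 × Fin m) ∈ ({j, partner j}ᶜ : Finset (Fin 2 × Fin m)) := by
    rintro ⟨i, hi⟩
    simp only [Finset.mem_compl, Finset.mem_insert, Finset.mem_singleton, not_or] at hi ⊢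
    refine ⟨fun h => hi.2 ?_, fun h => hi.1 ?_⟩
    · rw [← h, partner_partner]
    · rw [← partner_partner i, h, partner_partner]
  set R : (({j, partner j}ᶜ : Finset (Fin 2 × Fin m)) → ℝ) → ℝ := fun x =>
    Real.exp (∑ i, (x i * (X₁ᵀ i ⬝ᵥ y) - 1 / 4 * (x i * (x i + ρ * x ⟨partner i, hmem i⟩))))
    with hR
  have hRm : Measurable R := by rw [hR]; fun_prop
  have hRe : ∀ β : Fin 2 × Fin m → ℝ, Real.exp (∑ i ∈ {j, partner j}ᶜ, (β i * (X₁ᵀ i ⬝ᵥ y) -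
      1 / 4 * (β i * (β i + ρ * β (partner i))))) = R fun i => β i := by
    intro β
    rw [hR, ← Finset.sum_coe_sort]
  have hK : ∏ i, gaussianPDFReal 0 1 (y i) ≠ 0 :=
    Finset.prod_ne_zero_iff.2 fun i _ => (gaussianPDFReal_pos 0 1 (y i) one_ne_zero).ne'
  have hI : ∫ β, R (fun i => β i) ∂coefPrior (Fin 2 × Fin m) ε τ ≠ 0 :=
    (integral_coefPrior_pos h0 h1 _ fun β => Real.exp_pos _).ne'
  obtain ⟨hZ, hZ'⟩ := lintegral_coefPrior_ne (τ := τ) h0 h1 (likelihood X₁ y)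
    (fun β => (likelihood_ne X₁ y β).1) (fun β => (likelihood_ne X₁ y β).2)
  refine ⟨((∫⁻ β, likelihood X₁ y β ∂coefPrior (Fin 2 × Fin m) ε τ)⁻¹).toReal *
    ((∏ i, gaussianPDFReal 0 1 (y i)) * ∫ β, R (fun i => β i) ∂coefPrior (Fin 2 × Fin m) ε τ),
    mul_ne_zero ?_ (mul_ne_zero hK hI), fun t => ?_⟩
  · rw [ENNReal.toReal_inv]
    exact inv_ne_zero (ENNReal.toReal_ne_zero.2 ⟨hZ, hZ'⟩)
  · rw [predictiveStar, integral_posterior _ (measurable_likelihood X₁ y)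
      fun β => (likelihood_ne X₁ y β).2]
    rw [mul_assoc, mul_assoc]
    congr 1
    have hG : Measurable fun x : ℝ × ℝ => gaussianPDFReal x.1 (olsVar X₂ j) t *
        Real.exp (blockLogLik ρ (X₁ᵀ j ⬝ᵥ y) (X₁ᵀ (partner j) ⬝ᵥ y) x.1 x.2) := by
      refine Measurable.mul ?_ ?_
      · exact measurable_uncurry_gaussianPDFReal.comp
          (measurable_fst.prodMk (measurable_const.prodMk measurable_const))
      · unfold blockLogLik; fun_prop
    rw [mul_comm (∫ β, R (fun i => β i) ∂coefPrior (Fin 2 × Fin m) ε τ),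
      ← integral_coefPrior_pair_mul (τ := τ) h0 h1 (ne_partner j) (fun u u' =>
      gaussianPDFReal u (olsVar X₂ j) t *
        Real.exp (blockLogLik ρ (X₁ᵀ j ⬝ᵥ y) (X₁ᵀ (partner j) ⬝ᵥ y) u u')) hG R hRm,
      ← integral_const_mul]
    refine integral_congr_ae (Eventually.of_forall fun β => ?_)
    simp only
    rw [likelihood_toReal, cmDens_mulVec hX₁ y j, hRe]
    ring

/-- The Bayes-optimal mirror statistic is the log-likelihood-ratio mirror statistic of its shift
experiment. -/
lemma mirrorStar_eq_mirrorLog (h0 : 0 < ε) (h1 : ε < 1) (hρ : |ρ| < 1)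
    (hX₁ : X₁ᵀ * X₁ = blockGram ρ m) (hX₂ : X₂ᵀ * X₂ = blockGram ρ m) (y₁ y₂ : Fin n → ℝ)
    (j : Fin 2 × Fin m) :
    mirrorStar ε τ X₁ X₂ y₁ y₂ j =
      mirrorLog ε (fun b b' => starMean ρ X₁ X₂ j (spikeVal τ b) (spikeVal τ b'))
        (secondDir ρ τ X₂ j) (Sum.elim y₁ y₂) := by
  have hw := one_sub_sq_pos hρ
  have hv := olsVar_eq hρ hX₂ j
  have hv0 : olsVar X₂ j ≠ 0 := by
    intro h
    rw [h, NNReal.coe_zero] at hv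
    exact absurd hv (by positivity)
  obtain ⟨C, hC, hP⟩ := exists_predictiveStar_eq (X₂ := X₂) (τ := τ) h0 h1 hX₁ y₁ j
  set T := ols X₂ y₂ j with hT
  set K : Bool → ℝ := fun b => ∑ b' : Bool, spikeWeight ε b * spikeWeight ε b' *
    Real.exp (blockLogLik ρ (X₁ᵀ j ⬝ᵥ y₁) (X₁ᵀ (partner j) ⬝ᵥ y₁) (spikeVal τ b) (spikeVal τ b'))
    with hK
  set v : ℝ := ((olsVar X₂ j : ℝ≥0) : ℝ) with hvd
  have hPt : ∀ t, predictiveStar ε τ X₁ X₂ y₁ j t = C * (gaussianPDFReal 0 (olsVar X₂ j) t *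
      (K false + K true * Real.exp (-(τ * τ / (2 * v))) * Real.exp (τ * t / v))) := by
    intro t
    rw [hP]
    simp only [Fintype.sum_bool, hK, gaussianPDFReal_eq_mul_exp (spikeVal τ _) _ t]
    simp only [spikeVal, cond_true, cond_false, zero_mul, zero_div, neg_zero, add_zero,
      Real.exp_zero,
      ← hvd, sub_eq_add_neg, Real.exp_add]
    ring
  rw [mirrorStar, ← hT, hPt, hPt, gaussianPDFReal_zero_neg,
    show τ * -T / v = -(τ * T / v) by ring,
    log_predictive_ratio hC (gaussianPDFReal_pos 0 _ T hv0).ne', mirrorLog]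
  -- `K` carries the first-half likelihood only; the joint density also contains the likelihood
  -- ratio of the second-half estimate at its observed value.
  have hm : ∀ b, margDens ε (fun b b' => starMean ρ X₁ X₂ j (spikeVal τ b) (spikeVal τ b')) b
      (Sum.elim y₁ y₂) = K b * Real.exp (-(spikeVal τ b * spikeVal τ b / (2 * v))) *
        Real.exp (spikeVal τ b * T / v) := by
    intro b
    rw [margDens, hK, Finset.sum_mul, Finset.sum_mul]
    refine Finset.sum_congr rfl fun b' _ => ?_
    have e : cmDens (starMean ρ X₁ X₂ j (spikeVal τ b) (spikeVal τ b')) (Sum.elim y₁ y₂) =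
        Real.exp (blockLogLik ρ (X₁ᵀ j ⬝ᵥ y₁) (X₁ᵀ (partner j) ⬝ᵥ y₁) (spikeVal τ b)
          (spikeVal τ b')) * (Real.exp (-(spikeVal τ b * spikeVal τ b / (2 * v))) *
        Real.exp (spikeVal τ b * T / v)) := by
      rw [cmDens, starMean_dotProduct_elim, starMean_dotProduct_starMean hρ hX₁ hX₂,
        ← Real.exp_add, ← Real.exp_add, hT, ols_eq_olsRow, hv, blockLogLik]
      congr 1
      field_simp
      ring
    rw [e]
    ring
  have hη : secondDir ρ τ X₂ j ⬝ᵥ Sum.elim y₁ y₂ = τ * T / v := by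
    rw [secondDir_dotProduct_elim, hT, ols_eq_olsRow, hv]
    field_simp
  rw [hm, hm, hη]
  simp [spikeVal]

/-- The mirror statistic `M̃` is the log-likelihood-ratio mirror statistic of its shift
experiment. -/
lemma mirrorTilde_eq_mirrorLog (h0 : 0 < ε) (h1 : ε < 1) (hρ : |ρ| < 1)
    (hX₁ : X₁ᵀ * X₁ = blockGram ρ m) (hX₂ : X₂ᵀ * X₂ = blockGram ρ m) (y₁ y₂ : Fin n → ℝ)
    (j : Fin 2 × Fin m) :
    mirrorTilde ε τ X₁ X₂ y₁ y₂ j =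
      mirrorLog ε (fun b _ => tildeMean ρ X₁ X₂ j (spikeVal τ b))
        (secondDir ρ τ X₂ j) (Sum.elim y₁ y₂) := by
  have hw := one_sub_sq_pos hρ
  have hv1 := olsVar_eq hρ hX₁ j
  have hv := olsVar_eq hρ hX₂ j
  have hv0 : olsVar X₂ j ≠ 0 := by
    intro h
    rw [h, NNReal.coe_zero] at hv
    exact absurd hv (by positivity)
  have hv10 : olsVar X₁ j ≠ 0 := by
    intro h
    rw [h, NNReal.coe_zero] at hv1
    exact absurd hv1 (by positivity)
  set S := ols X₁ y₁ j with hS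
  set T := ols X₂ y₂ j with hT
  set L : ℝ → ℝ≥0∞ := fun b => gaussianPDF b (olsVar X₁ j) S with hL
  have hLm : Measurable L := measurable_uncurry_gaussianPDF.comp
    (f := fun b : ℝ => (b, olsVar X₁ j, S)) (by fun_prop)
  set Z := ∫⁻ b, L b ∂spikeSlab ε τ with hZd
  have hZ : Z = ENNReal.ofReal (1 - ε) * L 0 + ENNReal.ofReal ε * L τ := by
    simp [hZd, spikeSlab, lintegral_add_measure, lintegral_smul_measure, lintegral_dirac]
  have hZ0 : Z ≠ 0 := by
    rw [hZ]
    have : ENNReal.ofReal ε * L τ ≠ 0 :=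
      mul_ne_zero (ENNReal.ofReal_pos.2 h0).ne' (gaussianPDF_pos _ hv10 _).ne'
    simp [this]
  have hZ1 : Z ≠ ∞ := by
    rw [hZ]
    exact ENNReal.add_ne_top.2 ⟨ENNReal.mul_ne_top ENNReal.ofReal_ne_top gaussianPDF_ne_top,
      ENNReal.mul_ne_top ENNReal.ofReal_ne_top gaussianPDF_ne_top⟩
  set v : ℝ := ((olsVar X₂ j : ℝ≥0) : ℝ) with hvd
  set K : Bool → ℝ := fun b => spikeWeight ε b *
    Real.exp (spikeVal τ b * S / v - spikeVal τ b * spikeVal τ b / (2 * v)) with hK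
  have hPt : ∀ t, predictiveTilde ε τ X₁ X₂ y₁ j t =
      (Z⁻¹.toReal * gaussianPDFReal 0 (olsVar X₁ j) S) * (gaussianPDFReal 0 (olsVar X₂ j) t *
      (K false + K true * Real.exp (-(τ * τ / (2 * v))) * Real.exp (τ * t / v))) := by
    intro t
    refine (integral_posterior (spikeSlab ε τ) hLm (fun b => gaussianPDF_ne_top)
      fun b => gaussianPDFReal b (olsVar X₂ j) t).trans ?_
    rw [← hZd, integral_spikeSlab h0 h1]
    simp only [Fintype.sum_bool, hK, hL, toReal_gaussianPDF,
      gaussianPDFReal_eq_mul_exp (spikeVal τ _) _ t, gaussianPDFReal_eq_mul_exp (spikeVal τ _) _ S]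
    simp only [spikeVal, cond_true, cond_false, zero_mul, zero_div, neg_zero, add_zero,
      Real.exp_zero,
      hv1.trans hv.symm, ← hvd, sub_eq_add_neg, Real.exp_add]
    ring
  have hC : Z⁻¹.toReal * gaussianPDFReal 0 (olsVar X₁ j) S ≠ 0 := by
    refine mul_ne_zero ?_ (gaussianPDFReal_pos 0 _ S hv10).ne'
    rw [ENNReal.toReal_inv]
    exact inv_ne_zero (ENNReal.toReal_ne_zero.2 ⟨hZ0, hZ1⟩)
  rw [mirrorTilde, ← hT, hPt, hPt, gaussianPDFReal_zero_neg,
    show τ * -T / v = -(τ * T / v) by ring,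
    log_predictive_ratio hC (gaussianPDFReal_pos 0 _ T hv0).ne', mirrorLog]
  have hm : ∀ b, margDens ε (fun b _ => tildeMean ρ X₁ X₂ j (spikeVal τ b)) b
      (Sum.elim y₁ y₂) = K b * Real.exp (-(spikeVal τ b * spikeVal τ b / (2 * v))) *
        Real.exp (spikeVal τ b * T / v) := by
    intro b
    -- The mean ignores the partner, so its state sums out.
    have hsum : ∑ b' : Bool, spikeWeight ε b' = 1 := by simp [spikeWeight]
    rw [margDens]
    simp_rw [mul_assoc, mul_comm (spikeWeight ε _) (cmDens _ _)]
    rw [← Finset.mul_sum, ← Finset.mul_sum, hsum, hK]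
    dsimp only
    rw [mul_one, mul_assoc, cmDens, tildeMean_dotProduct_elim,
      tildeMean_dotProduct_tildeMean hρ hX₁ hX₂, ← Real.exp_add, ← Real.exp_add, hT, hS,
      ols_eq_olsRow, ols_eq_olsRow, hv]
    congr 2
    field_simp
    ring
  have hη : secondDir ρ τ X₂ j ⬝ᵥ Sum.elim y₁ y₂ = τ * T / v := by
    rw [secondDir_dotProduct_elim, hT, ols_eq_olsRow, hv]
    field_simp
  rw [hm, hm, hη]
  simp [spikeVal]

end

/-! ### The sign-sum statistic at one coefficient -/

/-- The sign-sum combination of two numbers. -/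
def signSum (a b : ℝ) : ℝ := Real.sign (a * b) * (|a| + |b|)

lemma measurable_signSum : Measurable fun x : ℝ × ℝ => signSum x.1 x.2 := by
  have hs : Measurable Real.sign := by
    unfold Real.sign
    exact Measurable.ite measurableSet_Iio measurable_const
      (Measurable.ite measurableSet_Ioi measurable_const measurable_const)
  have := hs.comp (measurable_fst.mul measurable_snd : Measurable fun x : ℝ × ℝ => x.1 * x.2)
  unfold signSum
  exact this.mul (by fun_prop)

lemma signSum_of_pos {a b : ℝ} (ha : 0 < a) (hb : 0 < b) : signSum a b = a + b := by
  rw [signSum, Real.sign_of_pos (mul_pos ha hb), abs_of_pos ha, abs_of_pos hb, one_mul]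

/-- A positive sign-sum forces equal signs, and then `|a| + |b| = |a + b|`. -/
lemma le_abs_add_of_le_signSum {a b t : ℝ} (ht : 0 < t) (h : t ≤ signSum a b) : t ≤ |a + b| := by
  rcases lt_trichotomy (a * b) 0 with hab | hab | hab
  · rw [signSum, Real.sign_of_neg hab] at h
    linarith [abs_nonneg a, abs_nonneg b]
  · rw [signSum, hab, Real.sign_zero, zero_mul] at h
    linarith
  · rw [signSum, Real.sign_of_pos hab, one_mul] at h
    refine h.trans_eq (((abs_add_eq_add_abs_iff a b).2 ?_).symm)
    rcases pos_and_pos_or_neg_and_neg_of_mul_pos hab with h | h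
    · exact Or.inl ⟨h.1.le, h.2.le⟩
    · exact Or.inr ⟨h.1.le, h.2.le⟩

/-- At this `t`, the test `α₁·z + α₂·z ≥ t` is the Bayes test. The sign-sum test differs from it in
two ways: it may also select when the sum is below `-t`, which at most doubles the false positives
by symmetry, and it may miss a spike when one of the coordinates is nonpositive, an event of
probability at most `exp (-s / 2)` for each. -/
lemma signSum_error_le {κ : Type} [Fintype κ] {ε c s : ℝ} {M : Bool → Bool → κ → ℝ}
    {α₁ α₂ : κ → ℝ} (h0 : 0 < ε) (h2 : ε < 1 / 2) (hc : 0 < c) (hs : 0 < s)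
    (hMf : ∀ b', M false b' = 0) (hMt : ∀ b', M true b' = c • α₁ + c • α₂)
    (h11 : (c • α₁) ⬝ᵥ (c • α₁) = s) (h22 : (c • α₂) ⬝ᵥ (c • α₂) = s)
    (h12 : (c • α₁) ⬝ᵥ (c • α₂) = 0) {t : ℝ} (ht : t = (Real.log ((1 - ε) / ε) + s) / c) :
    ∫ z in {z | t ≤ signSum (α₁ ⬝ᵥ z) (α₂ ⬝ᵥ z)}, margDens ε M false z ∂stdGauss κ +
        ∫ z in {z | t ≤ signSum (α₁ ⬝ᵥ z) (α₂ ⬝ᵥ z)}ᶜ, margDens ε M true z ∂stdGauss κ ≤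
      3 * bayesErr ε M + 2 * (ε * Real.exp (-(s / 2))) := by
  have h1 : ε < 1 := by linarith
  have h21 : (c • α₂) ⬝ᵥ (c • α₁) = 0 := by rw [dotProduct_comm, h12]
  have hlog : 0 < Real.log ((1 - ε) / ε) := Real.log_pos ((one_lt_div h0).2 (by linarith))
  have htp : 0 < t := by rw [ht]; positivity
  have hct : c * t = Real.log ((1 - ε) / ε) + s := by rw [ht]; field_simp
  have hf : ∀ z, margDens ε M false z = 1 - ε := by
    intro z
    simp only [margDens, hMf, cmDens, Fintype.sum_bool, spikeWeight, cond_true, cond_false,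
      zero_dotProduct, zero_div, sub_zero, Real.exp_zero]
    ring
  have hg : ∀ z, margDens ε M true z = ε * Real.exp (c * (α₁ ⬝ᵥ z + α₂ ⬝ᵥ z) - s) := by
    intro z
    have hn : (c • α₁ + c • α₂) ⬝ᵥ (c • α₁ + c • α₂) = 2 * s := by
      rw [add_dotProduct, dotProduct_add, dotProduct_add, h11, h22, h12, h21]; ring
    simp only [margDens, hMt, cmDens, Fintype.sum_bool, spikeWeight, cond_true, cond_false, hn]
    rw [add_dotProduct, smul_dotProduct, smul_dotProduct, smul_eq_mul, smul_eq_mul,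
      show c * (α₁ ⬝ᵥ z) + c * (α₂ ⬝ᵥ z) - 2 * s / 2 = c * (α₁ ⬝ᵥ z + α₂ ⬝ᵥ z) - s by ring]
    ring
  -- `t` is the level of `α₁·z + α₂·z` at which the two densities coincide.
  have hthr : 1 - ε = ε * Real.exp (c * t - s) := by
    rw [hct, add_sub_cancel_right, Real.exp_log (div_pos (by linarith) h0)]
    field_simp
  have hma : ∀ α : κ → ℝ, Measurable fun z : κ → ℝ => α ⬝ᵥ z := fun α => measurable_dotProduct α
  set S := {z : κ → ℝ | t ≤ signSum (α₁ ⬝ᵥ z) (α₂ ⬝ᵥ z)} with hS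
  set U := {z : κ → ℝ | t ≤ (α₁ + α₂) ⬝ᵥ z} with hU
  set V := {z : κ → ℝ | t ≤ (-(α₁ + α₂)) ⬝ᵥ z} with hV
  set P := {z : κ → ℝ | (c • α₁) ⬝ᵥ z ≤ 0} with hP
  set Q := {z : κ → ℝ | (c • α₂) ⬝ᵥ z ≤ 0} with hQ
  have hUm : MeasurableSet U := measurableSet_le measurable_const (hma _)
  have hVm : MeasurableSet V := measurableSet_le measurable_const (hma _)
  have hPm : MeasurableSet P := measurableSet_le (hma _) measurable_const
  have hQm : MeasurableSet Q := measurableSet_le (hma _) measurable_const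
  have hsub1 : S ⊆ U ∪ V := by
    intro z hz
    rcases le_abs'.1 (le_abs_add_of_le_signSum htp hz) with h | h
    · right
      change t ≤ (-(α₁ + α₂)) ⬝ᵥ z
      rw [neg_dotProduct, add_dotProduct]
      linarith
    · left
      change t ≤ (α₁ + α₂) ⬝ᵥ z
      rw [add_dotProduct]
      exact h
  have hsub2 : Sᶜ ⊆ Uᶜ ∪ (P ∪ Q) := by
    intro z hz
    by_contra hn
    simp only [Set.mem_union, not_or, Set.mem_compl_iff, not_not] at hn
    obtain ⟨hzU, hzP, hzQ⟩ := hn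
    have hzU : t ≤ (α₁ + α₂) ⬝ᵥ z := hzU
    have hzP : 0 < (c • α₁) ⬝ᵥ z := not_le.1 hzP
    have hzQ : 0 < (c • α₂) ⬝ᵥ z := not_le.1 hzQ
    rw [smul_dotProduct, smul_eq_mul] at hzP hzQ
    refine hz ?_
    change t ≤ signSum (α₁ ⬝ᵥ z) (α₂ ⬝ᵥ z)
    rw [signSum_of_pos (pos_of_mul_pos_right hzP hc.le) (pos_of_mul_pos_right hzQ hc.le),
      ← add_dotProduct]
    exact hzU
  have hint : ∀ b (A : Set (κ → ℝ)), IntegrableOn (margDens ε M b) A (stdGauss κ) :=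
    fun b A => (integrable_margDens b).integrableOn
  have hnn : ∀ b (A : Set (κ → ℝ)), 0 ≤ᵐ[(stdGauss κ).restrict A] margDens ε M b :=
    fun b A => Eventually.of_forall fun z => (margDens_pos h0 h1 b z).le
  have hUV : ∀ b (A B : Set (κ → ℝ)), MeasurableSet B →
      ∫ z in A ∪ B, margDens ε M b z ∂stdGauss κ ≤
        ∫ z in A, margDens ε M b z ∂stdGauss κ + ∫ z in B, margDens ε M b z ∂stdGauss κ := by
    intro b A B hB
    rw [← Set.sdiff_union_self, setIntegral_union Set.disjoint_sdiff_left hB (hint _ _) (hint _ _)]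
    exact add_le_add_left (setIntegral_mono_set (hint _ _) (hnn _ _)
      (LE.le.eventuallyLE Set.sdiff_subset)) _
  have hU1 : ∫ z in U, margDens ε M false z ∂stdGauss κ ≤ bayesErr ε M := by
    refine (setIntegral_le_mul_bayesErr h0 h1 hUm false (C := 1) (fun z hz => ?_)
      zero_le_one).trans_eq (one_mul _)
    have hz : t ≤ (α₁ + α₂) ⬝ᵥ z := hz
    rw [add_dotProduct] at hz
    rw [one_mul]
    refine le_min le_rfl ?_
    rw [hf, hg, hthr]
    gcongr
  have hU2 : ∫ z in Uᶜ, margDens ε M true z ∂stdGauss κ ≤ bayesErr ε M := by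
    refine (setIntegral_le_mul_bayesErr h0 h1 hUm.compl true (C := 1) (fun z hz => ?_)
      zero_le_one).trans_eq (one_mul _)
    have hz : (α₁ + α₂) ⬝ᵥ z < t := not_le.1 hz
    rw [add_dotProduct] at hz
    rw [one_mul]
    refine le_min ?_ le_rfl
    rw [hf, hg, hthr]
    gcongr
  -- Under the null the density is the constant `1 - ε`, and the standard Gaussian is symmetric.
  have hVU : ∫ z in V, margDens ε M false z ∂stdGauss κ =
      ∫ z in U, margDens ε M false z ∂stdGauss κ := by
    simp_rw [hf, setIntegral_const, smul_eq_mul]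
    congr 1
    refine (measureReal_dotProduct _ measurableSet_Ici).trans
      (Eq.trans ?_ (measureReal_dotProduct _ measurableSet_Ici).symm)
    rw [neg_dotProduct, dotProduct_neg, neg_neg]
  have hη : ∀ α : κ → ℝ, (c • α) ⬝ᵥ (c • α) = s → (∀ b', (c • α) ⬝ᵥ M true b' = s) →
      ∫ z in {z | (c • α) ⬝ᵥ z ≤ 0}, margDens ε M true z ∂stdGauss κ ≤
        ε * Real.exp (-(s / 2)) := by
    intro α hα hαM
    refine (setIntegral_dotProduct_le_exp h0 (c • α) (fun b' => by rw [hαM, hα])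
      (by rw [hα]; exact hs) (by rw [hα]; exact hs.le)).trans_eq ?_
    rw [hα]
    congr 3
    field_simp
    ring
  have hPi := hη α₁ h11 fun b' => by rw [hMt, dotProduct_add, h11, h12, add_zero]
  have hQi := hη α₂ h22 fun b' => by rw [hMt, dotProduct_add, h22, h21, zero_add]
  have hF : ∫ z in S, margDens ε M false z ∂stdGauss κ ≤ 2 * bayesErr ε M := by
    refine (setIntegral_mono_set (hint _ _) (hnn _ _) (LE.le.eventuallyLE hsub1)).trans
      ((hUV false U V hVm).trans ?_)
    rw [hVU]
    linarith
  have hG : ∫ z in Sᶜ, margDens ε M true z ∂stdGauss κ ≤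
      bayesErr ε M + 2 * (ε * Real.exp (-(s / 2))) := by
    refine (setIntegral_mono_set (hint _ _) (hnn _ _) (LE.le.eventuallyLE hsub2)).trans
      ((hUV true Uᶜ (P ∪ Q) (hPm.union hQm)).trans ?_)
    have := hUV true P Q hQm
    linarith
  linarith

/-! ### Rates -/

section Rates

lemma numFeat_pos {m : ℕ} (hm : 0 < m) : 0 < numFeat m := by
  unfold numFeat; positivity

lemma tendsto_log_numFeat : Tendsto (fun m => Real.log (numFeat m)) atTop atTop :=
  Real.tendsto_log_atTop.comp
    ((tendsto_natCast_atTop_atTop (R := ℝ)).const_mul_atTop two_pos)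

lemma rarity_eq_exp (ϑ : ℝ) {m : ℕ} (hm : 0 < m) :
    rarity ϑ m = Real.exp (-(ϑ * Real.log (numFeat m))) := by
  rw [rarity, Real.rpow_def_of_pos (numFeat_pos hm)]
  ring_nf

lemma eventually_rarity_lt {ϑ : ℝ} (hϑ : 0 < ϑ) : ∀ᶠ m in atTop, rarity ϑ m < 1 / 2 := by
  have h : Tendsto (rarity ϑ) atTop (𝓝 0) :=
    (tendsto_rpow_neg_atTop hϑ).comp
      ((tendsto_natCast_atTop_atTop (R := ℝ)).const_mul_atTop two_pos)
  exact h.eventually_lt_const (by norm_num)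

lemma strength_mul_self {r : ℝ} (hr : 0 < r) {m : ℕ} (hL : 0 < Real.log (numFeat m)) :
    strength r m * strength r m = 2 * r * Real.log (numFeat m) :=
  Real.mul_self_sqrt (by positivity)

/-- A sequence that is `p ^ (f + o(1))` has the rate `f`. -/
lemma hasRate_of_exp_bounds {H : ℕ → ℝ} {f : ℝ}
    (h : ∀ δ, 0 < δ → ∀ᶠ m in atTop, Real.exp ((f - δ) * Real.log (numFeat m)) ≤ H m ∧
      H m ≤ Real.exp ((f + δ) * Real.log (numFeat m))) : HasRate numFeat H f := by
  have hp : Tendsto numFeat atTop atTop :=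
    (tendsto_natCast_atTop_atTop (R := ℝ)).const_mul_atTop two_pos
  refine ⟨fun m => H m / numFeat m ^ f, fun δ hδ => ⟨?_, ?_⟩, ?_⟩
  -- Applying the bounds with `δ / 2` leaves a factor `p ^ (δ / 2)` that diverges.
  · refine tendsto_atTop_mono' _ ?_ ((tendsto_rpow_atTop (half_pos hδ)).comp hp)
    filter_upwards [h (δ / 2) (half_pos hδ), eventually_gt_atTop 0] with m hm hm0
    have hpm := numFeat_pos hm0
    have h1 : numFeat m ^ (f - δ / 2) ≤ H m := by
      rw [Real.rpow_def_of_pos hpm, mul_comm]; exact hm.1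
    have h2 : numFeat m ^ (δ / 2) = numFeat m ^ (f - δ / 2) / numFeat m ^ f * numFeat m ^ δ := by
      rw [← Real.rpow_sub hpm, ← Real.rpow_add hpm]; ring_nf
    simp only [Function.comp_apply]
    rw [h2]
    gcongr
  · refine tendsto_of_tendsto_of_tendsto_of_le_of_le' tendsto_const_nhds
      ((tendsto_rpow_neg_atTop (half_pos hδ)).comp hp) ?_ ?_
    · filter_upwards [h (δ / 2) (half_pos hδ), eventually_gt_atTop 0] with m hm hm0
      have hpm := numFeat_pos hm0
      have := (Real.exp_pos _).trans_le hm.1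
      positivity
    · filter_upwards [h (δ / 2) (half_pos hδ), eventually_gt_atTop 0] with m hm hm0
      have hpm := numFeat_pos hm0
      have h1 : H m ≤ numFeat m ^ (f + δ / 2) := by
        rw [Real.rpow_def_of_pos hpm, mul_comm (Real.log _)]; exact hm.2
      have h2 : numFeat m ^ (-(δ / 2)) =
          numFeat m ^ (f + δ / 2) / numFeat m ^ f * numFeat m ^ (-δ) := by
        rw [← Real.rpow_sub hpm, ← Real.rpow_add hpm]; ring_nf
      simp only [Function.comp_apply]
      rw [h2]
      gcongr
  · filter_upwards [eventually_gt_atTop 0] with m hm0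
    rw [div_mul_cancel₀ _ (Real.rpow_pos_of_pos (numFeat_pos hm0) _).ne']

/-- Losses `exp (C (√L + 1))` from the slab bounds are smaller than any power `p ^ δ`. -/
lemma eventually_mul_sqrt_log_le (C : ℝ) {δ : ℝ} (hδ : 0 < δ) :
    ∀ᶠ m in atTop, C * (√(Real.log (numFeat m)) + 1) ≤ δ * Real.log (numFeat m) := by
  have h1 : Tendsto (fun m => √(Real.log (numFeat m))) atTop atTop :=
    Real.tendsto_sqrt_atTop.comp tendsto_log_numFeat
  filter_upwards [h1.eventually_ge_atTop (2 * |C| / δ + 1), tendsto_log_numFeat.eventually_ge_atTop 0]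
    with m hm hL
  have h2 := Real.mul_self_sqrt hL
  have h3 : 2 * |C| ≤ δ * √(Real.log (numFeat m)) := by
    have : 2 * |C| / δ ≤ √(Real.log (numFeat m)) := by linarith
    rw [div_le_iff₀ hδ] at this
    linarith
  have h4 : 1 ≤ √(Real.log (numFeat m)) := by
    have : 0 ≤ 2 * |C| / δ := by positivity
    linarith
  have h5 := le_abs_self C
  have h6 := abs_nonneg C
  nlinarith

lemma numFeat_eq_exp {m : ℕ} (hm : 0 < m) : numFeat m = Real.exp (Real.log (numFeat m)) :=
  (Real.exp_log (numFeat_pos hm)).symm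

/-- Rates from bounds on the errors at each feature. -/
lemma hasRate_of_feature_bounds {ϑ r E : ℝ} {n : ℕ → ℕ}
    {X₁ X₂ : ∀ m, Matrix (Fin (n m)) (Fin 2 × Fin m) ℝ}
    (W : ∀ m, (Fin (n m) → ℝ) → (Fin (n m) → ℝ) → Fin 2 × Fin m → ℝ) (thr : ℕ → ℝ → ℝ)
    (err : ∀ m, Fin 2 × Fin m → ℝ → ℝ)
    (herr : ∀ᶠ m in atTop, ∀ t, falsePos (rarity ϑ m) (strength r m) (X₁ m) (X₂ m) (W m) t +
      falseNeg (rarity ϑ m) (strength r m) (X₁ m) (X₂ m) (W m) t = ∑ j, err m j t)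
    (hlow : ∀ δ, 0 < δ → ∀ᶠ m in atTop, ∀ u, 0 < u → ∀ j,
      Real.exp (-((E + δ) * Real.log (numFeat m))) ≤ err m j (thr m u))
    (hupp : ∀ δ, 0 < δ → ∀ᶠ m in atTop, ∃ u, 0 < u ∧ ∀ j,
      err m j (thr m u) ≤ Real.exp (-((E - δ) * Real.log (numFeat m)))) :
    HasRate numFeat (fun m => hammStar (rarity ϑ m) (strength r m) (X₁ m) (X₂ m) (W m) (thr m))
      (1 - E) := by
  refine hasRate_of_exp_bounds fun δ hδ => ?_
  filter_upwards [herr, hlow δ hδ, hupp δ hδ, eventually_gt_atTop 0] with m he hl ⟨u, hu, hup⟩ hm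
  -- There are `2 m = p` features, so summing a bound uniform in `j` adds 1 to the exponent of `p`.
  have hcard : ∀ c : ℝ, ∑ _j : Fin 2 × Fin m, Real.exp (c * Real.log (numFeat m)) =
      Real.exp ((1 + c) * Real.log (numFeat m)) := by
    intro c
    rw [Finset.sum_const, Finset.card_univ, Fintype.card_prod, Fintype.card_fin, Fintype.card_fin,
      nsmul_eq_mul, add_mul, Real.exp_add, one_mul, ← numFeat_eq_exp hm, numFeat]
    push_cast
    rfl
  have hl' : ∀ u : Set.Ioi (0 : ℝ), Real.exp ((1 - E - δ) * Real.log (numFeat m)) ≤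
      falsePos (rarity ϑ m) (strength r m) (X₁ m) (X₂ m) (W m) (thr m u) +
      falseNeg (rarity ϑ m) (strength r m) (X₁ m) (X₂ m) (W m) (thr m u) := by
    intro u
    rw [he, show 1 - E - δ = 1 + -(E + δ) by ring, ← hcard]
    refine Finset.sum_le_sum fun j _ => ?_
    rw [neg_mul]
    exact hl u u.2 j
  constructor
  · have : Nonempty (Set.Ioi (0 : ℝ)) := ⟨⟨1, Set.mem_Ioi.2 one_pos⟩⟩
    exact le_ciInf hl'
  · refine (ciInf_le ⟨_, Set.forall_mem_range.2 hl'⟩ (⟨u, hu⟩ : Set.Ioi (0 : ℝ))).trans ?_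
    rw [he, show 1 - E + δ = 1 + -(E - δ) by ring, ← hcard]
    refine Finset.sum_le_sum fun j _ => ?_
    rw [neg_mul]
    exact hup j

/-- The error of the test `t ≤ F` in the shift experiment with means `M`. -/
def testErr {κ : Type} [Fintype κ] (ε : ℝ) (M : Bool → Bool → κ → ℝ) (F : (κ → ℝ) → ℝ) (t : ℝ) :
    ℝ :=
  ∫ z in {z | t ≤ F z}, margDens ε M false z ∂stdGauss κ +
    ∫ z in {z | t ≤ F z}ᶜ, margDens ε M true z ∂stdGauss κ

lemma bayesErr_le_testErr {κ : Type} [Fintype κ] {ε : ℝ} {M : Bool → Bool → κ → ℝ}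
    {F : (κ → ℝ) → ℝ} (hF : Measurable F) (t : ℝ) : bayesErr ε M ≤ testErr ε M F t :=
  bayesErr_le _ (measurableSet_le measurable_const hF)

/-- The bound is uniform over the index type and the means, because the sample space changes with
`m` and the means with `j`. -/
lemma eventually_exp_le_bayesErr {ϑ : ℝ} (hϑ : 0 < ϑ) {Δ : Bool → Bool → ℝ}
    (hΔ : ∀ b b', 0 < Δ b b') {δ : ℝ} (hδ : 0 < δ) :
    ∀ᶠ m in atTop, ∀ (κ : Type) [Fintype κ] (M : Bool → Bool → κ → ℝ),
      (∀ b b', (M true b' - M false b) ⬝ᵥ (M true b' - M false b) =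
        2 * Δ b b' * Real.log (numFeat m)) →
      Real.exp (-((bayesExp ϑ Δ + δ) * Real.log (numFeat m))) ≤ bayesErr (rarity ϑ m) M := by
  obtain ⟨C, hC⟩ := exists_exp_le_bayesErr ϑ Δ hΔ
  filter_upwards [eventually_mul_sqrt_log_le C hδ, eventually_rarity_lt hϑ, eventually_gt_atTop 0,
    tendsto_log_numFeat.eventually_gt_atTop 0] with m h1 h2 h3 h4 κ _ M hM
  refine le_trans (Real.exp_le_exp.2 ?_) (hC κ _ _ M h4 (rarity_eq_exp ϑ h3) h2.le hM)
  nlinarith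

/-- The rate of a statistic that is the log-likelihood-ratio mirror statistic of a shift experiment
at each feature. -/
lemma hasRate_of_mirrorLog {ϑ r a : ℝ} (hϑ : 0 < ϑ) (hr : 0 < r) (ha : 0 < a)
    {Δ : Bool → Bool → ℝ} (hΔ : ∀ b b', 0 < Δ b b') {n : ℕ → ℕ}
    {X₁ X₂ : ∀ m, Matrix (Fin (n m)) (Fin 2 × Fin m) ℝ}
    (W : ∀ m, (Fin (n m) → ℝ) → (Fin (n m) → ℝ) → Fin 2 × Fin m → ℝ)
    (mean : ∀ m, Fin 2 × Fin m → ℝ → ℝ → Fin (n m) ⊕ Fin (n m) → ℝ)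
    (η : ∀ m, Fin 2 × Fin m → Fin (n m) ⊕ Fin (n m) → ℝ)
    (hmean : ∀ m j, Measurable fun x : ℝ × ℝ => mean m j x.1 x.2)
    (hW : ∀ m, 0 < rarity ϑ m → rarity ϑ m < 1 → ∀ β e₁ e₂ j,
      W m (response (X₁ m) β e₁) (response (X₂ m) β e₂) j =
        mirrorLog (rarity ϑ m)
          (fun b b' => mean m j (spikeVal (strength r m) b) (spikeVal (strength r m) b')) (η m j)
          (mean m j (β j) (β (partner j)) + Sum.elim e₁ e₂))
    (hM : ∀ m, 0 < Real.log (numFeat m) → ∀ j b b',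
      (mean m j (spikeVal (strength r m) true) (spikeVal (strength r m) b') -
          mean m j (spikeVal (strength r m) false) (spikeVal (strength r m) b)) ⬝ᵥ
        (mean m j (spikeVal (strength r m) true) (spikeVal (strength r m) b') -
          mean m j (spikeVal (strength r m) false) (spikeVal (strength r m) b)) =
      2 * Δ b b' * Real.log (numFeat m))
    (hη : ∀ m j b', η m j ⬝ᵥ mean m j (spikeVal (strength r m) true) (spikeVal (strength r m) b') =
      η m j ⬝ᵥ η m j)
    (hηη : ∀ m, 0 < Real.log (numFeat m) → ∀ j,
      η m j ⬝ᵥ η m j = 2 * a * Real.log (numFeat m)) :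
    HasRate numFeat (fun m => hammStar (rarity ϑ m) (strength r m) (X₁ m) (X₂ m) (W m)
      fun u => 2 * u * Real.log (numFeat m)) (1 - min (bayesExp ϑ Δ) (ϑ + a)) := by
  set M : ∀ m, Fin 2 × Fin m → Bool → Bool → Fin (n m) ⊕ Fin (n m) → ℝ := fun m j b b' =>
    mean m j (spikeVal (strength r m) b) (spikeVal (strength r m) b') with hMd
  refine hasRate_of_feature_bounds W (fun m u => 2 * u * Real.log (numFeat m))
    (fun m j t => testErr (rarity ϑ m) (M m j) (mirrorLog (rarity ϑ m) (M m j) (η m j)) t)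
    ?_ (fun δ hδ => ?_) (fun δ hδ => ?_)
  · filter_upwards [eventually_rarity_lt hϑ, eventually_gt_atTop 0,
      tendsto_log_numFeat.eventually_gt_atTop 0] with m h2 hm hL t
    have h0 : 0 < rarity ϑ m := by rw [rarity_eq_exp ϑ hm]; exact Real.exp_pos _
    have h1 : rarity ϑ m < 1 := by linarith
    have hτ : strength r m ≠ 0 := (Real.sqrt_pos.2 (by positivity)).ne'
    obtain ⟨e1, e2⟩ := falsePos_falseNeg_eq_sum (X₁ := X₁ m) (X₂ := X₂ m) (W := W m) h0 h1 hτ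
      partner ne_partner (mean m) (hmean m) (fun j => mirrorLog (rarity ϑ m) (M m j) (η m j))
      (fun j => measurable_mirrorLog _) (hW m h0 h1) t
    rw [e1, e2, ← Finset.sum_add_distrib]
    rfl
  -- `C` dominates the excess in `(√(2 a L) + 1)² / 2 = a L + √(2 a L) + 1/2`, together with the
  -- constant `(2π)^(-1/2)`.
  · obtain ⟨C, hC⟩ : ∃ C : ℝ, C = |Real.log (√(2 * Real.pi))⁻¹| + √(2 * a) + 1 := ⟨_, rfl⟩
    filter_upwards [eventually_exp_le_bayesErr hϑ hΔ hδ, eventually_mul_sqrt_log_le C hδ,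
      eventually_rarity_lt hϑ, eventually_gt_atTop 0,
      tendsto_log_numFeat.eventually_gt_atTop 0] with m hB hS h2 hm hL u hu j
    have h0 : 0 < rarity ϑ m := by rw [rarity_eq_exp ϑ hm]; exact Real.exp_pos _
    have h1 : rarity ϑ m < 1 := by linarith
    have hp : 0 < (√(2 * Real.pi))⁻¹ := inv_pos.2 (Real.sqrt_pos.2 (by positivity))
    -- Whichever term is the minimum has its own lower bound: the Bayes error for any test, or the
    -- misses forced by `η·z ≤ 0`.
    rcases le_total (bayesExp ϑ Δ) (ϑ + a) with h | h
    · rw [min_eq_left h]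
      exact (hB _ (M m j) (hM m hL j)).trans (bayesErr_le_testErr (measurable_mirrorLog _) _)
    · rw [min_eq_right h]
      have hηp : 0 < η m j ⬝ᵥ η m j := by rw [hηη m hL]; positivity
      have ht : 0 < 2 * u * Real.log (numFeat m) := by positivity
      have key := le_mirrorLog_falseNeg (M := M m j) h0 h1 (η m j) (hη m j) hηp ht
      have hFP : 0 ≤ ∫ z in {z | 2 * u * Real.log (numFeat m) ≤
          mirrorLog (rarity ϑ m) (M m j) (η m j) z}, margDens (rarity ϑ m) (M m j) false z
            ∂stdGauss (Fin (n m) ⊕ Fin (n m)) :=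
        integral_nonneg fun z => (margDens_pos h0 h1 _ _).le
      refine le_trans (le_trans ?_ key) (le_add_of_nonneg_left hFP)
      rw [rarity_eq_exp ϑ hm, ← Real.exp_log hp, ← Real.exp_add, ← Real.exp_add, Real.exp_le_exp,
        hηη m hL]
      have hsq : √(2 * a * Real.log (numFeat m)) * √(2 * a * Real.log (numFeat m)) =
        2 * a * Real.log (numFeat m) := Real.mul_self_sqrt (by positivity)
      have hsm : √(2 * a * Real.log (numFeat m)) = √(2 * a) * √(Real.log (numFeat m)) :=
        Real.sqrt_mul (by positivity) _
      have hb := neg_abs_le (Real.log (√(2 * Real.pi))⁻¹)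
      have hq := Real.sqrt_nonneg (Real.log (numFeat m))
      have hq2 := Real.sqrt_nonneg (2 * a)
      have hab := abs_nonneg (Real.log (√(2 * Real.pi))⁻¹)
      rw [hC] at hS
      have h3 : √(2 * a * Real.log (numFeat m)) + |Real.log (√(2 * Real.pi))⁻¹| + 1 ≤
          δ * Real.log (numFeat m) := by
        rw [hsm]
        nlinarith [mul_nonneg hab hq]
      nlinarith
  · obtain ⟨u, hu, L₀, hL₀⟩ := exists_mirrorLog_error_le ϑ Δ ha hδ
    filter_upwards [tendsto_log_numFeat.eventually_ge_atTop L₀, eventually_rarity_lt hϑ,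
      eventually_gt_atTop 0, tendsto_log_numFeat.eventually_gt_atTop 0] with m hL1 h2 hm hL
    exact ⟨u, hu, fun j => hL₀ _ _ _ (M m j) (η m j) hL1 (rarity_eq_exp ϑ hm) (by linarith)
      (hM m hL j) (hη m j) (hηη m hL j)⟩

end Rates

/-! ### The rates of the three mirror statistics -/

/-- The statistic depends on the data only through inner products with the means and `η`, so the
actual responses may be replaced by the shift experiment. -/
lemma mirrorLog_congr {κ : Type} [Fintype κ] {ε : ℝ} {M : Bool → Bool → κ → ℝ} {η z z' : κ → ℝ}
    (hM : ∀ b b', M b b' ⬝ᵥ z = M b b' ⬝ᵥ z') (hη : η ⬝ᵥ z = η ⬝ᵥ z') :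
    mirrorLog ε M η z = mirrorLog ε M η z' := by
  have h : ∀ b, margDens ε M b z = margDens ε M b z' := fun b => by
    simp only [margDens, cmDens, hM]
  simp only [mirrorLog, h, hη]

/-- The squared distances of the means of the experiment behind the Bayes-optimal mirror statistic,
as multiples of `2 log p`. -/
def starDist (r ρ : ℝ) (b b' : Bool) : ℝ :=
  r * ((1 + 2 * ρ * ((bif b' then 1 else 0) - bif b then 1 else 0) +
    ((bif b' then 1 else 0) - bif b then 1 else 0) ^ 2) / 2 + (1 - ρ ^ 2) / 2)

section MainRates

variable {ϑ r ρ : ℝ} {n : ℕ → ℕ} {X₁ X₂ : ∀ m, Matrix (Fin (n m)) (Fin 2 × Fin m) ℝ}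

lemma starDist_pos (hr : 0 < r) (hρ : |ρ| < 1) (b b' : Bool) : 0 < starDist r ρ b b' := by
  have hw := one_sub_sq_pos hρ
  obtain ⟨h1, h2⟩ := abs_lt.1 hρ
  refine mul_pos hr ?_
  cases b <;> cases b' <;> norm_num <;> nlinarith

lemma hasRate_mirrorStar (hϑ : 0 < ϑ) (hr : 0 < r) (hρ : |ρ| < 1)
    (hX₁ : ∀ m, (X₁ m)ᵀ * X₁ m = blockGram ρ m) (hX₂ : ∀ m, (X₂ m)ᵀ * X₂ m = blockGram ρ m) :
    HasRate numFeat (hammMirrorStar ϑ r X₁ X₂)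
      (1 - min (bayesExp ϑ (starDist r ρ)) (ϑ + (1 - ρ ^ 2) * r / 2)) := by
  have hw := one_sub_sq_pos hρ
  refine hasRate_of_mirrorLog hϑ hr (by positivity) (starDist_pos hr hρ)
    (fun m => mirrorStar (rarity ϑ m) (strength r m) (X₁ m) (X₂ m))
    (fun m => starMean ρ (X₁ m) (X₂ m)) (fun m => secondDir ρ (strength r m) (X₂ m))
    (fun m j => measurable_starMean j) (fun m h0 h1 β e₁ e₂ j => ?_) (fun m hL j b b' => ?_)
    (fun m j b' => ?_) (fun m hL j => ?_)
  · rw [mirrorStar_eq_mirrorLog h0 h1 hρ (hX₁ m) (hX₂ m)]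
    exact mirrorLog_congr
      (fun b b' => starMean_dotProduct_response hρ (hX₁ m) (hX₂ m) j _ _ β e₁ e₂)
      (secondDir_dotProduct_response hρ (hX₂ m) _ j β e₁ e₂)
  · have hτ := strength_mul_self hr hL
    simp only [sub_dotProduct, dotProduct_sub, starMean_dotProduct_starMean hρ (hX₁ m) (hX₂ m)]
    cases b <;> cases b' <;> simp only [spikeVal, starDist, cond_true, cond_false] <;>
      first
        | linear_combination (1 / 2 + (1 - ρ ^ 2) / 2) * hτ
        | linear_combination (1 + ρ + (1 - ρ ^ 2) / 2) * hτ
        | linear_combination (1 - ρ + (1 - ρ ^ 2) / 2) * hτ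
  · rw [secondDir_dotProduct_starMean hρ (hX₂ m), secondDir_dotProduct_self hρ (hX₂ m)]
    rfl
  · rw [secondDir_dotProduct_self hρ (hX₂ m), strength_mul_self hr hL]
    ring

lemma tildeMean_dist (hr : 0 < r) (hρ : |ρ| < 1) {m : ℕ} (hL : 0 < Real.log (numFeat m))
    (hX₁ : (X₁ m)ᵀ * X₁ m = blockGram ρ m) (hX₂ : (X₂ m)ᵀ * X₂ m = blockGram ρ m)
    (j : Fin 2 × Fin m) :
    (tildeMean ρ (X₁ m) (X₂ m) j (spikeVal (strength r m) true) -
        tildeMean ρ (X₁ m) (X₂ m) j (spikeVal (strength r m) false)) ⬝ᵥ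
      (tildeMean ρ (X₁ m) (X₂ m) j (spikeVal (strength r m) true) -
        tildeMean ρ (X₁ m) (X₂ m) j (spikeVal (strength r m) false)) =
      2 * ((1 - ρ ^ 2) * r) * Real.log (numFeat m) := by
  have hτ := strength_mul_self hr hL
  simp only [sub_dotProduct, dotProduct_sub, tildeMean_dotProduct_tildeMean hρ hX₁ hX₂, spikeVal,
    cond_true, cond_false]
  linear_combination (1 - ρ ^ 2) * hτ

lemma hasRate_mirrorTilde (hϑ : 0 < ϑ) (hr : 0 < r) (hρ : |ρ| < 1)
    (hX₁ : ∀ m, (X₁ m)ᵀ * X₁ m = blockGram ρ m) (hX₂ : ∀ m, (X₂ m)ᵀ * X₂ m = blockGram ρ m) :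
    HasRate numFeat (hammMirrorTilde ϑ r X₁ X₂)
      (1 - min (bayesExp ϑ fun _ _ => (1 - ρ ^ 2) * r) (ϑ + (1 - ρ ^ 2) * r / 2)) := by
  have hw := one_sub_sq_pos hρ
  refine hasRate_of_mirrorLog hϑ hr (by positivity) (fun _ _ => by positivity)
    (fun m => mirrorTilde (rarity ϑ m) (strength r m) (X₁ m) (X₂ m))
    (fun m j u _ => tildeMean ρ (X₁ m) (X₂ m) j u) (fun m => secondDir ρ (strength r m) (X₂ m))
    (fun m j => measurable_tildeMean j) (fun m h0 h1 β e₁ e₂ j => ?_)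
    (fun m hL j b b' => tildeMean_dist hr hρ hL (hX₁ m) (hX₂ m) j)
    (fun m j b' => ?_) (fun m hL j => ?_)
  · rw [mirrorTilde_eq_mirrorLog h0 h1 hρ (hX₁ m) (hX₂ m)]
    refine mirrorLog_congr (fun b b' => ?_) ?_
    · rw [dotProduct_add, tildeMean_dotProduct_tildeMean hρ (hX₁ m) (hX₂ m),
        tildeMean_dotProduct_elim, tildeMean_dotProduct_elim]
      simp only [response, dotProduct_add, olsRow_dotProduct_mulVec hρ (hX₁ m),
        olsRow_dotProduct_mulVec hρ (hX₂ m)]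
      ring
    · rw [dotProduct_add, secondDir_dotProduct_tildeMean hρ (hX₂ m),
        secondDir_dotProduct_elim, secondDir_dotProduct_elim]
      simp only [response, dotProduct_add, olsRow_dotProduct_mulVec hρ (hX₂ m)]
      ring
  · rw [secondDir_dotProduct_tildeMean hρ (hX₂ m), secondDir_dotProduct_self hρ (hX₂ m)]
    rfl
  · rw [secondDir_dotProduct_self hρ (hX₂ m), strength_mul_self hr hL]
    ring

/-- Hence the Bayes exponent at distance `Δ` is at most `ϑ + Δ / 4`, and misses of exponent `ϑ + Δ /
2` do not affect the rate. -/
lemma sq_max_div_le {Δ : ℝ} (hϑ : 0 < ϑ) (hΔ : 0 < Δ) :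
    (max (Δ - ϑ) 0) ^ 2 / (4 * Δ) ≤ Δ / 4 := by
  have h1 : max (Δ - ϑ) 0 ≤ Δ := max_le (by linarith) hΔ.le
  have h0 : 0 ≤ max (Δ - ϑ) 0 := le_max_right _ _
  rw [div_le_div_iff₀ (by positivity) (by norm_num)]
  nlinarith

lemma hasRate_mirrorSum (hϑ : 0 < ϑ) (hr : 0 < r) (hρ : |ρ| < 1)
    (hX₁ : ∀ m, (X₁ m)ᵀ * X₁ m = blockGram ρ m) (hX₂ : ∀ m, (X₂ m)ᵀ * X₂ m = blockGram ρ m) :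
    HasRate numFeat (hammMirrorSum ϑ r X₁ X₂)
      (1 - bayesExp ϑ fun _ _ => (1 - ρ ^ 2) * r) := by
  have hw := one_sub_sq_pos hρ
  have hD : 0 < (1 - ρ ^ 2) * r := by positivity
  set α₁ : ∀ m, Fin 2 × Fin m → Fin (n m) ⊕ Fin (n m) → ℝ := fun m j =>
    Sum.elim (olsRow (X₁ m) j) 0 with hα₁
  set α₂ : ∀ m, Fin 2 × Fin m → Fin (n m) ⊕ Fin (n m) → ℝ := fun m j =>
    Sum.elim 0 (olsRow (X₂ m) j) with hα₂
  set M : ∀ m, Fin 2 × Fin m → Bool → Bool → Fin (n m) ⊕ Fin (n m) → ℝ := fun m j b _ =>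
    tildeMean ρ (X₁ m) (X₂ m) j (spikeVal (strength r m) b) with hMd
  have hFm : ∀ m j, Measurable fun z => signSum (α₁ m j ⬝ᵥ z) (α₂ m j ⬝ᵥ z) := fun m j =>
    measurable_signSum.comp ((measurable_dotProduct _).prodMk (measurable_dotProduct _))
  refine hasRate_of_feature_bounds (fun m => mirrorSum (X₁ m) (X₂ m))
    (fun m u => √(2 * u * Real.log (numFeat m)))
    (fun m j t => testErr (rarity ϑ m) (M m j) (fun z => signSum (α₁ m j ⬝ᵥ z) (α₂ m j ⬝ᵥ z)) t)
    ?_ (fun δ hδ => ?_) (fun δ hδ => ?_)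
  · filter_upwards [eventually_rarity_lt hϑ, eventually_gt_atTop 0,
      tendsto_log_numFeat.eventually_gt_atTop 0] with m h2 hm hL t
    have h0 : 0 < rarity ϑ m := by rw [rarity_eq_exp ϑ hm]; exact Real.exp_pos _
    have hτ : strength r m ≠ 0 := (Real.sqrt_pos.2 (by positivity)).ne'
    obtain ⟨e1, e2⟩ := falsePos_falseNeg_eq_sum (X₁ := X₁ m) (X₂ := X₂ m)
      (W := mirrorSum (X₁ m) (X₂ m)) h0 (by linarith) hτ
      partner ne_partner (fun j u _ => tildeMean ρ (X₁ m) (X₂ m) j u)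
      (fun j => measurable_tildeMean j) (fun j z => signSum (α₁ m j ⬝ᵥ z) (α₂ m j ⬝ᵥ z))
      (hFm m) (fun β e₁ e₂ j => by
        obtain ⟨h1, h2⟩ := olsRow_response_eq hρ (hX₁ m) (hX₂ m) j β e₁ e₂
        rw [mirrorSum, h1, h2]
        rfl) t
    rw [e1, e2, ← Finset.sum_add_distrib]
    rfl
  · filter_upwards [eventually_exp_le_bayesErr hϑ (fun _ _ => hD) hδ,
      tendsto_log_numFeat.eventually_gt_atTop 0] with m hB hL u hu j
    exact (hB _ (M m j) fun b b' => tildeMean_dist hr hρ hL (hX₁ m) (hX₂ m) j).trans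
      (bayesErr_le_testErr (hFm m j) _)
  · filter_upwards [eventually_rarity_lt hϑ, eventually_gt_atTop 0,
      tendsto_log_numFeat.eventually_gt_atTop 0,
      tendsto_log_numFeat.eventually_ge_atTop (Real.log 14 / δ)] with m h2 hm hL hLδ
    have h0 : 0 < rarity ϑ m := by rw [rarity_eq_exp ϑ hm]; exact Real.exp_pos _
    have hτ : 0 < strength r m := Real.sqrt_pos.2 (by positivity)
    have hτ2 := strength_mul_self hr hL
    set L := Real.log (numFeat m) with hLd
    set c := strength r m * ((1 - ρ ^ 2) / 2) with hc
    have hc0 : 0 < c := by positivity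
    have hs0 : 0 < (1 - ρ ^ 2) * r * L := by positivity
    have hcc : c * c * (2 / (1 - ρ ^ 2)) = (1 - ρ ^ 2) * r * L := by
      have : c * c = 2 * r * L * ((1 - ρ ^ 2) / 2) ^ 2 := by rw [← hτ2, hc]; ring
      rw [this]
      field_simp
    set ε := rarity ϑ m with hε
    set t := (Real.log ((1 - ε) / ε) + (1 - ρ ^ 2) * r * L) / c with ht
    have ht0 : 0 < t := by
      have : 0 < Real.log ((1 - ε) / ε) := Real.log_pos ((one_lt_div h0).2 (by linarith))
      positivity
    -- This `u` solves `√(2 u L) = t`, the threshold of the Bayes test on the sum.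
    refine ⟨t ^ 2 / (2 * L), by positivity, fun j => ?_⟩
    have htu : √(2 * (t ^ 2 / (2 * L)) * L) = t := by
      rw [show 2 * (t ^ 2 / (2 * L)) * L = t ^ 2 by field_simp, Real.sqrt_sq ht0.le]
    rw [htu]
    have key := signSum_error_le (M := M m j) (α₁ := α₁ m j) (α₂ := α₂ m j) h0 h2 hc0 hs0
      (fun b' => by
        ext i
        cases i <;> simp [hMd, tildeMean, spikeVal])
      (fun b' => by
        ext i
        cases i <;> simp [hMd, tildeMean, spikeVal, hα₁, hα₂, hc])
      (by
        rw [smul_dotProduct, dotProduct_smul, sumElim_dotProduct_sumElim, zero_dotProduct,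
          olsRow_dotProduct_self hρ (hX₁ m), smul_eq_mul, smul_eq_mul, ← hcc]
        ring)
      (by
        rw [smul_dotProduct, dotProduct_smul, sumElim_dotProduct_sumElim, zero_dotProduct,
          olsRow_dotProduct_self hρ (hX₂ m), smul_eq_mul, smul_eq_mul, ← hcc]
        ring)
      (by
        rw [smul_dotProduct, dotProduct_smul, sumElim_dotProduct_sumElim, zero_dotProduct,
          dotProduct_zero]
        simp) ht
    have hB := bayesErr_le_exp (M := M m j) (Δ := fun _ _ => (1 - ρ ^ 2) * r) h0 (by linarith)
      (rarity_eq_exp ϑ hm) hL.le fun b b' => tildeMean_dist hr hρ hL (hX₁ m) (hX₂ m) j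
    set E := bayesExp ϑ fun _ _ => (1 - ρ ^ 2) * r with hE
    have hEle : E ≤ ϑ + (1 - ρ ^ 2) * r / 2 := by
      rw [hE, bayesExp_const hϑ.le hD]
      linarith [sq_max_div_le hϑ hD]
    have hεE : ε * Real.exp (-((1 - ρ ^ 2) * r * L / 2)) ≤ Real.exp (-(E * L)) := by
      rw [hε, rarity_eq_exp ϑ hm, ← Real.exp_add, Real.exp_le_exp]
      nlinarith
    -- `14 = 3 · 4 + 2`: three Bayes errors, each at most `4 exp (-E L)`, and two misses by sign.
    have h14 : 14 * Real.exp (-(E * L)) ≤ Real.exp (-((E - δ) * L)) := by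
      rw [div_le_iff₀ hδ] at hLδ
      rw [← Real.exp_log (by norm_num : (0 : ℝ) < 14), ← Real.exp_add, Real.exp_le_exp]
      linarith
    refine le_trans ?_ h14
    refine le_trans key ?_
    linarith

/-! ### Comparison of the exponents -/

lemma sq_max_div_mono {Δ Δ' : ℝ} (hϑ : 0 < ϑ) (hΔ : 0 < Δ) (h : Δ ≤ Δ') :
    (max (Δ - ϑ) 0) ^ 2 / (4 * Δ) ≤ (max (Δ' - ϑ) 0) ^ 2 / (4 * Δ') := by
  have := pairExp_mono (le_refl 0) (le_refl ϑ) hΔ h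
  rw [pairExp_zero_left hϑ.le hΔ, pairExp_zero_left hϑ.le (hΔ.trans_le h)] at this
  linarith

lemma sq_max_div_lt {Δ Δ' : ℝ} (hϑ : 0 < ϑ) (hΔ : 0 < Δ) (h : Δ < Δ') (hΔ' : ϑ < Δ') :
    (max (Δ - ϑ) 0) ^ 2 / (4 * Δ) < (max (Δ' - ϑ) 0) ^ 2 / (4 * Δ') := by
  have h0 : 0 < Δ' := hΔ.trans h
  have h1 : 0 < Δ' - ϑ := by linarith
  rw [max_eq_left h1.le]
  rcases le_total Δ ϑ with h2 | h2
  · rw [max_eq_right (by linarith)]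
    simp only [ne_eq, OfNat.ofNat_ne_zero, not_false_eq_true, zero_pow, zero_div]
    positivity
  · rw [max_eq_left (by linarith), div_lt_div_iff₀ (by positivity) (by positivity)]
    -- Since `(Δ - ϑ)² / Δ = Δ - 2ϑ + ϑ² / Δ`, the increment is `(Δ' - Δ)(1 - ϑ² / (Δ Δ'))`.
    have h3 : 0 < Δ * Δ' - ϑ * ϑ := by nlinarith
    nlinarith [mul_pos (sub_pos.2 h) h3]

lemma one_sub_abs_mul_eq (ρ : ℝ) : (1 - |ρ|) * (3 + |ρ|) = 3 - 2 * |ρ| - ρ ^ 2 := by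
  rw [← sq_abs ρ]; ring

/-- The lower bound for the exponent of the Bayes error behind the Bayes-optimal mirror
statistic. -/
lemma le_bayesExp_starDist (hϑ : 0 < ϑ) (hr : 0 < r) (hρ : |ρ| < 1) :
    ϑ + min ((max ((1 - ρ ^ 2 / 2) * r - ϑ) 0) ^ 2 / (4 * (1 - ρ ^ 2 / 2) * r))
        ((1 - |ρ|) * (3 + |ρ|) * r / 8) ≤ bayesExp ϑ (starDist r ρ) := by
  have hw := one_sub_sq_pos hρ
  have hκ : 0 < (1 - ρ ^ 2 / 2) * r := mul_pos (by nlinarith) hr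
  have hp := starDist_pos hr hρ
  have h1 : (max ((1 - ρ ^ 2 / 2) * r - ϑ) 0) ^ 2 / (4 * (1 - ρ ^ 2 / 2) * r) + ϑ =
      pairExp 0 ϑ ((1 - ρ ^ 2 / 2) * r) := by
    rw [pairExp_zero_left hϑ.le hκ, mul_assoc]; ring
  have hd : ∀ b, starDist r ρ b b = (1 - ρ ^ 2 / 2) * r := by
    intro b
    simp only [starDist, sub_self]
    ring
  obtain ⟨ha1, ha2⟩ := abs_le.1 (le_refl |ρ|)
  refine le_bayesExp fun b b' => ?_
  rcases eq_or_ne b b' with rfl | hbb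
  -- Equal partner states: the distance does not depend on `b`, and a common spike only raises both
  -- prior exponents.
  · refine (add_le_add_right (min_le_left _ _) ϑ).trans ?_
    rw [add_comm, h1]
    exact pairExp_mono (by cases b <;> simp [stateExp, hϑ.le])
      (by cases b <;> simp [stateExp, hϑ.le]) hκ (hd b).ge
  -- Unequal partner states: the prior exponents are `0, 2ϑ` or `ϑ, ϑ`, so weight `1/2` gives `ϑ + Δ
  -- / 4` with `Δ = (3 ± 2ρ - ρ²) r / 2`.
  · refine (add_le_add_right (min_le_right _ _) ϑ).trans
      (le_trans ?_ (chernoffExp_le_pairExp (l := 1 / 2) (by norm_num) (by norm_num) _ _ (hp b b')))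
    rw [one_sub_abs_mul_eq]
    cases b <;> cases b' <;> simp only [ne_eq, not_true_eq_false, reduceCtorEq,
      not_false_eq_true] at hbb <;>
      simp only [chernoffExp, stateExp, starDist, cond_true, cond_false] <;> nlinarith

end MainRates

end

end MirrorStat

theorem mainTheorem3 (ϑ r ρ : ℝ) (hϑ₀ : 0 < ϑ) (hϑ₁ : ϑ < 1) (hr : 0 < r) (hρ : |ρ| < 1)
    (n : ℕ → ℕ) (X₁ X₂ : ∀ m, Matrix (Fin (n m)) (Fin 2 × Fin m) ℝ)
    (hX₁ : ∀ m, (X₁ m)ᵀ * X₁ m = blockGram ρ m)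
    (hX₂ : ∀ m, (X₂ m)ᵀ * X₂ m = blockGram ρ m) :
    ∃ fStar fTilde fSum : ℝ,
      HasRate numFeat (hammMirrorStar ϑ r X₁ X₂) fStar ∧
      HasRate numFeat (hammMirrorTilde ϑ r X₁ X₂) fTilde ∧
      HasRate numFeat (hammMirrorSum ϑ r X₁ X₂) fSum ∧
      fStar ≤ 1 - ϑ - min
        ((max ((1 - ρ ^ 2 / 2) * r - ϑ) 0) ^ 2 / (4 * (1 - ρ ^ 2 / 2) * r))
        ((1 - |ρ|) * (3 + |ρ|) * r / 8) ∧
      fStar ≤ fTilde ∧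
      fTilde = fSum ∧
      fSum = 1 - ϑ - (max ((1 - ρ ^ 2) * r - ϑ) 0) ^ 2 / (4 * (1 - ρ ^ 2) * r) ∧
      (ϑ / (1 - ρ ^ 2 / 2) < r → ρ ≠ 0 → fStar < fTilde) := by
  have hw := one_sub_sq_pos hρ
  have hD : 0 < (1 - ρ ^ 2) * r := by positivity
  have hκ : 0 < 1 - ρ ^ 2 / 2 := by nlinarith
  have hT := bayesExp_const hϑ₀.le hD
  have hle := sq_max_div_le hϑ₀ hD
  have hmin : min (bayesExp ϑ fun _ _ => (1 - ρ ^ 2) * r) (ϑ + (1 - ρ ^ 2) * r / 2) =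
      bayesExp ϑ fun _ _ => (1 - ρ ^ 2) * r := min_eq_left (by linarith)
  have hTilde := hasRate_mirrorTilde hϑ₀ hr hρ hX₁ hX₂
  rw [hmin] at hTilde
  have hS := le_bayesExp_starDist hϑ₀ hr hρ
  set A := (max ((1 - ρ ^ 2 / 2) * r - ϑ) 0) ^ 2 / (4 * (1 - ρ ^ 2 / 2) * r) with hA
  set B := (1 - |ρ|) * (3 + |ρ|) * r / 8 with hB
  -- The gap is `(1 - |ρ|)² r / 8`; as the exponent gain of `M̃` is at most `(1 - ρ²) r / 4`, the
  -- term `B` always exceeds it strictly.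
  have hGB : (1 - ρ ^ 2) * r / 4 < B := by
    have : (1 - ρ ^ 2) * 2 < (1 - |ρ|) * (3 + |ρ|) := by
      rw [one_sub_abs_mul_eq]
      nlinarith [sq_abs ρ, abs_nonneg ρ, mul_pos (sub_pos.2 hρ) (sub_pos.2 hρ)]
    have := mul_lt_mul_of_pos_right this hr
    rw [hB]
    linarith
  -- So the forced misses of `M⋆`, of exponent `ϑ + (1 - ρ²) r / 2`, do not weaken the bound by `min
  -- A B`.
  have hBw : B ≤ (1 - ρ ^ 2) * r / 2 := by
    have : (1 - |ρ|) * (3 + |ρ|) ≤ (1 - ρ ^ 2) * 4 := by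
      rw [one_sub_abs_mul_eq]
      nlinarith [sq_abs ρ, abs_nonneg ρ]
    have := mul_le_mul_of_nonneg_right this hr.le
    rw [hB]
    linarith
  have hStar : ϑ + min A B ≤ min (bayesExp ϑ (starDist r ρ)) (ϑ + (1 - ρ ^ 2) * r / 2) :=
    le_min hS (by linarith [min_le_right A B])
  have hGA : (max ((1 - ρ ^ 2) * r - ϑ) 0) ^ 2 / (4 * ((1 - ρ ^ 2) * r)) ≤ A := by
    rw [hA, mul_assoc 4]
    exact sq_max_div_mono hϑ₀ hD (mul_le_mul_of_nonneg_right (by nlinarith [sq_nonneg ρ]) hr.le)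
  refine ⟨_, _, _, hasRate_mirrorStar hϑ₀ hr hρ hX₁ hX₂, hTilde,
    hasRate_mirrorSum hϑ₀ hr hρ hX₁ hX₂, by linarith, ?_, rfl, ?_, fun h hρ0 => ?_⟩
  · rw [hT]
    have := le_min hGA (by linarith : _ ≤ B)
    linarith
  · rw [hT, ← mul_assoc 4]
    ring
  · rw [hT]
    -- Strictness needs a strictly larger distance, which is `ρ ≠ 0`, and a distance above `ϑ`,
    -- which is the lower bound on `r`.
    have hGA' : (max ((1 - ρ ^ 2) * r - ϑ) 0) ^ 2 / (4 * ((1 - ρ ^ 2) * r)) < A := by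
      rw [hA, mul_assoc 4]
      refine sq_max_div_lt hϑ₀ hD (mul_lt_mul_of_pos_right ?_ hr) ?_
      · have := pow_pos (abs_pos.2 hρ0) 2
        rw [sq_abs] at this
        linarith
      · rw [div_lt_iff₀ hκ] at h
        linarith
    have := lt_min hGA' (by linarith : _ < B)
    linarith
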